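/- Let $m,n\ge 1$. For a field $K$, $q\in K^\times$ and $v_1,\dots,v_m\in K^\times$, let $H(m,1,n)$ be the cyclotomic Hecke algebra: the associative unital $K$-algebra generated by $\tau,\sigma_1,\dots,\sigma_{n-1}$ with the relations $$\sigma_i\sigma_{i+1}\sigma_i=\sigma_{i+1}\sigma_i\sigma_{i+1},\qquad \sigma_i\sigma_j=\sigma_j\sigma_i\ (|i-j|>1),\qquad \tau\sigma_1\tau\sigma_1=\sigma_1\tau\sigma_1\tau,\qquad \tau\sigma_i=\sigma_i\tau\ (i>1),$$ $$\sigma_i^2=(q-q^{-1})\sigma_i+1,\qquad (\tau-v_1)\cdots(\tau-v_m)=0 .$$ For $k\le n$ there is the natural homomorphism $H(m,1,k)\to H(m,1,n)$ that sends each generator to the generator of the same name. The Jucys--Murphy elements of $H(m,1,n)$ are $J_1=\tau$, $J_{i+1}=\sigma_iJ_i\sigma_i$, $i=1,\dots,n-1$. Assume one of the following. 1. (Semisimple case.) $K=\mathbb C$, all $v_j\ne 0$, $q\neq 0$, $1+q^2+\dots+q^{2N}\ne 0$ for all integers $0\le N<n$, $q^{2i}v_j-v_k\neq 0$ for all $j\ne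 k$ and all integers $-n<i<n$, and, if $n\ge 2$, $q^2\neq 1$. 2. (Generic case.) $K=\mathbb C(q,v_1,\dots,v_m)$ is the field of rational functions in the indeterminates $q,v_1,\dots,v_m$. Then: (a) The Jucys--Murphy elements distinguish basis elements in the sum of all irreducible representations of $H(m,1,n)$: every irreducible representation has a $K$-basis of common eigenvectors of $J_1,\dots,J_n$; different vectors of this basis have different strings of eigenvalues $(a_1,\dots,a_n)$; and non-isomorphic irreducible representations have no string of eigenvalues in common. (b) The set $\{J_1,\dots,J_n\}$ is maximal commutative in $H(m,1,n)$: the subalgebra $K[J_1,\dots,J_n]$ that it generates is commutative and is contained in no strictly larger commutative subalgebra. (c) $K[J_1,\dots,J_n]$ coincides with the subalgebra of $H(m,1,n)$ generated by the union of (the images of) the centres of $H(m,1,k)$, $k=1,\dots,n$. -/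

import Mathlib

noncomputable section

namespace CyclotomicHecke

/-- The generators of `H(m,1,n)`: the element `τ` and the elements `σ₁, …, σₙ₋₁`.
Here `sigma i h` stands for `σᵢ₊₁`, so `i` runs over `0, …, n - 2`. -/
inductive Gen (n : ℕ) : Type
  | tau : Gen n
  | sigma (i : ℕ) (h : i + 1 < n) : Gen n

section Algebra

variable (K : Type*) [Field K]

/-- `τ` in the free associative algebra. -/
def freeTau (n : ℕ) : FreeAlgebra K (Gen n) := FreeAlgebra.ι K Gen.tau

/-- `σᵢ₊₁` in the free associative algebra. -/
def freeSigma {n : ℕ} (i : ℕ) (h : i + 1 < n) : FreeAlgebra K (Gen n) :=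
  FreeAlgebra.ι K (Gen.sigma i h)

variable {K} {m : ℕ}

/-- The defining relations of the cyclotomic Hecke algebra `H(m,1,n)` with parameters
`q` and `v₁, …, vₘ`. -/
inductive Rel (q : K) (v : Fin m → K) (n : ℕ) :
    FreeAlgebra K (Gen n) → FreeAlgebra K (Gen n) → Prop
  /-- `σᵢ σᵢ₊₁ σᵢ = σᵢ₊₁ σᵢ σᵢ₊₁` -/
  | braid (i : ℕ) (h : i + 1 < n) (h' : i + 1 + 1 < n) : Rel q v n
      (freeSigma K i h * freeSigma K (i + 1) h' * freeSigma K i h)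
      (freeSigma K (i + 1) h' * freeSigma K i h * freeSigma K (i + 1) h')
  /-- `σᵢ σⱼ = σⱼ σᵢ` for `|i - j| > 1` -/
  | sigma_comm (i j : ℕ) (hi : i + 1 < n) (hj : j + 1 < n) (hij : i + 1 < j) : Rel q v n
      (freeSigma K i hi * freeSigma K j hj)
      (freeSigma K j hj * freeSigma K i hi)
  /-- `τ σ₁ τ σ₁ = σ₁ τ σ₁ τ` -/
  | tau_braid (h : 0 + 1 < n) : Rel q v n
      (freeTau K n * freeSigma K 0 h * freeTau K n * freeSigma K 0 h)
      (freeSigma K 0 h * freeTau K n * freeSigma K 0 h * freeTau K n)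
  /-- `τ σᵢ = σᵢ τ` for `i > 1` -/
  | tau_comm (i : ℕ) (h : i + 1 < n) (hi : 0 < i) : Rel q v n
      (freeTau K n * freeSigma K i h)
      (freeSigma K i h * freeTau K n)
  /-- `σᵢ² = (q - q⁻¹) σᵢ + 1` -/
  | quadratic (i : ℕ) (h : i + 1 < n) : Rel q v n
      (freeSigma K i h ^ 2)
      ((q - q⁻¹) • freeSigma K i h + 1)
  /-- `(τ - v₁) ⋯ (τ - vₘ) = 0` -/
  | cyclotomic : Rel q v n
      (Polynomial.aeval (freeTau K n) (∏ j : Fin m, (Polynomial.X - Polynomial.C (v j))))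
      0

/-- The cyclotomic Hecke algebra `H(m,1,n)` over the field `K` (for `n ≥ 1`), with parameters
`q` and `v₁, …, vₘ`. -/
abbrev H (q : K) (v : Fin m → K) (n : ℕ) : Type _ := RingQuot (Rel q v n)

variable (q : K) (v : Fin m → K)

/-- The generator `τ` of `H(m,1,n)`. -/
def tau (n : ℕ) : H q v n := RingQuot.mkAlgHom K (Rel q v n) (freeTau K n)

/-- The generator `σᵢ₊₁` of `H(m,1,n)`. -/
def sigma {n : ℕ} (i : ℕ) (h : i + 1 < n) : H q v n :=
  RingQuot.mkAlgHom K (Rel q v n) (freeSigma K i h)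

/-- The Jucys–Murphy elements: `jucysMurphy q v i h` is `Jᵢ₊₁`, where
`J₁ = τ` and `Jᵢ₊₁ = σᵢ Jᵢ σᵢ`. -/
def jucysMurphy {n : ℕ} : (i : ℕ) → i < n → H q v n
  | 0, _ => tau q v n
  | i + 1, h => sigma q v i h * jucysMurphy i (Nat.lt_of_succ_lt h) * sigma q v i h

/-- The set `{J₁, …, Jₙ}` of Jucys–Murphy elements of `H(m,1,n)`. -/
def jucysMurphySet (n : ℕ) : Set (H q v n) :=
  Set.range fun i : Fin n => jucysMurphy q v i.1 i.2

/-- The images of the generators of `H(m,1,k)` in `H(m,1,n)`, for `k ≤ n`. -/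
def genMap {k n : ℕ} (hkn : k ≤ n) : Gen k → H q v n
  | Gen.tau => tau q v n
  | Gen.sigma i h => sigma q v i (h.trans_le hkn)

@[simp] theorem lift_freeTau {k n : ℕ} (hkn : k ≤ n) :
    FreeAlgebra.lift K (genMap q v hkn) (freeTau K k) = tau q v n := by
  simp [freeTau, genMap]

@[simp] theorem lift_freeSigma {k n : ℕ} (hkn : k ≤ n) (i : ℕ) (h : i + 1 < k) :
    FreeAlgebra.lift K (genMap q v hkn) (freeSigma K i h) = sigma q v i (h.trans_le hkn) := by
  simp [freeSigma, genMap]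

theorem lift_rel {k n : ℕ} (hkn : k ≤ n) ⦃x y : FreeAlgebra K (Gen k)⦄ (hxy : Rel q v k x y) :
    FreeAlgebra.lift K (genMap q v hkn) x = FreeAlgebra.lift K (genMap q v hkn) y := by
  cases hxy with
  | braid i h h' =>
    simpa [sigma] using RingQuot.mkAlgHom_rel K
      (Rel.braid (q := q) (v := v) i (h.trans_le hkn) (h'.trans_le hkn))
  | sigma_comm i j hi hj hij =>
    simpa [sigma] using RingQuot.mkAlgHom_rel K
      (Rel.sigma_comm (q := q) (v := v) i j (hi.trans_le hkn) (hj.trans_le hkn) hij)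
  | tau_braid h =>
    simpa [sigma, tau] using RingQuot.mkAlgHom_rel K
      (Rel.tau_braid (q := q) (v := v) (h.trans_le hkn))
  | tau_comm i h hi =>
    simpa [sigma, tau] using RingQuot.mkAlgHom_rel K
      (Rel.tau_comm (q := q) (v := v) i (h.trans_le hkn) hi)
  | quadratic i h =>
    simpa [sigma] using RingQuot.mkAlgHom_rel K
      (Rel.quadratic (q := q) (v := v) i (h.trans_le hkn))
  | cyclotomic =>
    have := RingQuot.mkAlgHom_rel K (Rel.cyclotomic (q := q) (v := v) (n := n))
    rw [← Polynomial.aeval_algHom_apply, map_zero] at this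
    rw [← Polynomial.aeval_algHom_apply, map_zero, lift_freeTau]
    exact this

/-- The natural homomorphism `H(m,1,k) → H(m,1,n)` for `k ≤ n`, sending each generator to the
generator of the same name. -/
def incl {k n : ℕ} (hkn : k ≤ n) : H q v k →ₐ[K] H q v n :=
  RingQuot.liftAlgHom K ⟨FreeAlgebra.lift K (genMap q v hkn), lift_rel q v hkn⟩

/-- The subalgebra of `H(m,1,n)` generated by the union of the centres of `H(m,1,k)`,
`k = 1, …, n`. -/
def centresSubalgebra (n : ℕ) : Subalgebra K (H q v n) :=
  Algebra.adjoin K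
    {x | ∃ (k : ℕ) (_ : 1 ≤ k) (hkn : k ≤ n), ∃ z ∈ Subalgebra.center K (H q v k),
      incl q v hkn z = x}

end Algebra

/-- A subset `S` of an algebra is a maximal commutative set if the subalgebra it generates (the
polynomials in the elements of `S`) is maximal among the commutative subalgebras. -/
def IsMaximalCommutativeSet (K : Type*) {A : Type*} [Field K] [Ring A] [Algebra K A]
    (S : Set A) : Prop :=
  Maximal (fun B : Subalgebra K A => ∀ x ∈ B, ∀ y ∈ B, x * y = y * x) (Algebra.adjoin K S)

/-- The Jucys–Murphy elements distinguish the basis elements in the sum of all irreducible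
representations of `H(m,1,n)`: every irreducible representation has a basis of common eigenvectors
of `J₁, …, Jₙ`; the strings of eigenvalues of different basis vectors are different; and a string
of eigenvalues that occurs in two irreducible representations forces them to be isomorphic. -/
def JucysMurphyDistinguish {K : Type} [Field K] {m : ℕ} (q : K) (v : Fin m → K) (n : ℕ) : Prop :=
  (∀ (V : Type) [AddCommGroup V] [Module K V] [Module (H q v n) V]
      [IsScalarTower K (H q v n) V] [IsSimpleModule (H q v n) V],
    ∃ (ι : Type) (b : Module.Basis ι K V) (a : ι → Fin n → K), Function.Injective a ∧
      ∀ (t : ι) (i : Fin n), jucysMurphy q v i.1 i.2 • b t = a t i • b t) ∧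
  (∀ (V W : Type) [AddCommGroup V] [Module K V] [Module (H q v n) V]
      [IsScalarTower K (H q v n) V] [IsSimpleModule (H q v n) V]
      [AddCommGroup W] [Module K W] [Module (H q v n) W]
      [IsScalarTower K (H q v n) W] [IsSimpleModule (H q v n) W]
      (a : Fin n → K) (x : V) (y : W), x ≠ 0 → y ≠ 0 →
      (∀ i : Fin n, jucysMurphy q v i.1 i.2 • x = a i • x) →
      (∀ i : Fin n, jucysMurphy q v i.1 i.2 • y = a i • y) →
      Nonempty (V ≃ₗ[H q v n] W))

/-- The field `ℂ(q, v₁, …, vₘ)` of rational functions in `m + 1` indeterminates; the variable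
`none` is `q` and the variable `some j` is `vⱼ`. -/
abbrev GenericField (m : ℕ) : Type := FractionRing (MvPolynomial (Option (Fin m)) ℂ)

/-- The indeterminate `q` of `ℂ(q, v₁, …, vₘ)`. -/
def genericQ (m : ℕ) : GenericField m :=
  algebraMap (MvPolynomial (Option (Fin m)) ℂ) (GenericField m) (MvPolynomial.X none)

/-- The indeterminates `vⱼ` of `ℂ(q, v₁, …, vₘ)`. -/
def genericV (m : ℕ) (j : Fin m) : GenericField m :=
  algebraMap (MvPolynomial (Option (Fin m)) ℂ) (GenericField m) (MvPolynomial.X (some j))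

/-- The restrictions on numerical parameters `q`, `v₁, …, vₘ` in the semisimple situation. -/
structure SemisimpleParameters {m : ℕ} (q : ℂ) (v : Fin m → ℂ) (n : ℕ) : Prop where
  q_ne_zero : q ≠ 0
  /-- `1 + q² + ⋯ + q²ᴺ ≠ 0` for all `N < n` -/
  sum_ne_zero : ∀ N : ℕ, N < n → ∑ i ∈ Finset.range (N + 1), q ^ (2 * i) ≠ 0
  /-- `q²ⁱ vⱼ - vₖ ≠ 0` for all `j ≠ k` and `-n < i < n` -/
  sub_ne_zero : ∀ i : ℤ, -(n : ℤ) < i → i < (n : ℤ) → ∀ j k : Fin m, j ≠ k →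
    q ^ (2 * i) * v j - v k ≠ 0
  v_ne_zero : ∀ j, v j ≠ 0

end CyclotomicHecke

end

/-! The argument is spectral, in the style of Okounkov and Vershik. It constructs no representations
and needs no dimension count: it works inside an arbitrary module and uses only the relations
between the σ's and the Jucys–Murphy elements (`IsJMSystem`) and the conditions on the parameters
(`SemisimpleOver`).

The main tool is the intertwiner U_i = σ_i(J_i − J_{i+1}) + (q − q⁻¹)J_{i+1}. It exchanges J_i and
J_{i+1}, and U_i² = −(J_{i+1} − q²J_i)(J_{i+1} − q⁻²J_i). So U_i sends a common eigenvector to one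
with two adjacent entries of its string exchanged, and the result is nonzero unless these entries
differ by a factor q^{±2}.

One induction on k proves together that J_1, …, J_k are diagonalizable on every module and that
their strings of eigenvalues are content strings (`jDiagonalizable_and_isContentString`). Content
strings imitate the contents of standard multitableaux: an entry is some v_j or a q^{±2}-neighbour
of an earlier entry, and equal entries enclose both neighbouring values. The parameters enter mainly
through `not_appendable_both`: c and q²c never extend the same string. This excludes Jordan blocks
of the next J, and makes U_i vanish on eigenvectors with neighbouring entries
(`inter_smul_eq_zero`).

Let x be a common eigenvector in a module over the algebra A. Rescaled intertwiners act as σ_i plus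
a scalar and satisfy the Yang–Baxter equation, so the vector reached from x along a reduced path
depends only on the permutation (`Reaches.unique`). The reached vectors span Ax
(`smul_mem_span_reaches`). A nontrivial reached permutation changes the string
(`SeparatedPerm.eq_one`), so the string of x has multiplicity one in Ax
(`IsJMSystem.exists_eq_smul`), and Ax is simple when x ≠ 0.

Multiplicity one gives the basis in (a). If x in V and y in W share a string, then (x, y) generates
a simple submodule of V × W that projects isomorphically to both factors. For (b), 1 is a sum of
elements r of K[J] that are common eigenvectors in the regular module; if z commutes with all J_i,
then zr has the string of r, so zr = cr and z lies in K[J]. For (c), J_1 + ⋯ + J_k is central in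
H(m,1,k), which gives one inclusion; the other is the argument of (b) inside H(m,1,k). -/

noncomputable section

namespace CyclotomicHecke

/-! ### Abstract Jucys–Murphy systems and conditions on the parameters -/

section System

variable {K A : Type*} [Field K] [Ring A] [Algebra K A] {m : ℕ}

/-- Elements `s i`, `J i` of an algebra that satisfy the relations between the generators `σᵢ₊₁`
and the Jucys–Murphy elements `Jᵢ₊₁` of `H(m,1,n)`, and generate the algebra. -/
structure IsJMSystem (q : K) (v : Fin m → K) (n : ℕ) (s J : ℕ → A) : Prop where
  quad : ∀ i, i + 1 < n → s i * s i = (q - q⁻¹) • s i + 1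
  braid : ∀ i, i + 2 < n → s i * s (i + 1) * s i = s (i + 1) * s i * s (i + 1)
  s_comm : ∀ i j, i + 1 < n → j + 1 < n → i + 1 < j → s i * s j = s j * s i
  J_succ : ∀ i, i + 1 < n → J (i + 1) = s i * J i * s i
  s_J : ∀ i j, i + 1 < n → j < n → j ≠ i → j ≠ i + 1 → s i * J j = J j * s i
  J_comm : ∀ i j, i < n → j < n → J i * J j = J j * J i
  cyclotomic : Polynomial.aeval (J 0) (∏ j : Fin m, (Polynomial.X - Polynomial.C (v j))) = 0
  generate : Algebra.adjoin K (insert (J 0) (s '' {i | i + 1 < n})) = ⊤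

/-- The restrictions on the parameters in the semisimple situation, over an arbitrary field. -/
structure SemisimpleOver (q : K) (v : Fin m → K) (n : ℕ) : Prop where
  q_ne_zero : q ≠ 0
  v_ne_zero : ∀ j, v j ≠ 0
  v_ne : ∀ j k, j ≠ k → v j ≠ v k
  pow_ne_one : 2 ≤ n → ∀ i, 1 ≤ i → i ≤ n → (q ^ 2) ^ i ≠ 1
  pow_mul_ne : ∀ i, i < n → ∀ j k, j ≠ k → v j * (q ^ 2) ^ i ≠ v k

end System

/-! ### Relations between generators and Jucys–Murphy elements in H(m,1,n) -/

section Relations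

variable {K : Type*} [Field K] {m : ℕ} (q : K) (v : Fin m → K)

/-- The generator `σᵢ₊₁`, extended by zero to all indices. -/
def sig (n i : ℕ) : H q v n := if h : i + 1 < n then sigma q v i h else 0

/-- The Jucys–Murphy element `Jᵢ₊₁`, extended by zero to all indices. -/
def jm (n i : ℕ) : H q v n := if h : i < n then jucysMurphy q v i h else 0

variable {n : ℕ}

theorem sig_of_lt {i : ℕ} (h : i + 1 < n) : sig q v n i = sigma q v i h := dif_pos h

theorem jm_of_lt {i : ℕ} (h : i < n) : jm q v n i = jucysMurphy q v i h := dif_pos h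

theorem jm_zero (h : 0 < n) : jm q v n 0 = tau q v n := by
  rw [jm_of_lt q v h, jucysMurphy]

theorem jm_succ {i : ℕ} (h : i + 1 < n) :
    jm q v n (i + 1) = sig q v n i * jm q v n i * sig q v n i := by
  rw [jm_of_lt q v h, jm_of_lt q v (Nat.lt_of_succ_lt h), sig_of_lt q v h, jucysMurphy]

theorem sig_quad {i : ℕ} (h : i + 1 < n) :
    sig q v n i * sig q v n i = (q - q⁻¹) • sig q v n i + 1 := by
  rw [sig_of_lt q v h, ← sq]
  simpa [sigma] using RingQuot.mkAlgHom_rel K (Rel.quadratic (q := q) (v := v) i h)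

theorem sig_braid {i : ℕ} (h : i + 2 < n) :
    sig q v n i * sig q v n (i + 1) * sig q v n i =
      sig q v n (i + 1) * sig q v n i * sig q v n (i + 1) := by
  rw [sig_of_lt q v h, sig_of_lt q v (Nat.lt_of_succ_lt h)]
  simpa [sigma] using RingQuot.mkAlgHom_rel K
    (Rel.braid (q := q) (v := v) i (Nat.lt_of_succ_lt h) h)

theorem sig_comm {i j : ℕ} (hi : i + 1 < n) (hj : j + 1 < n) (hij : i + 1 < j) :
    sig q v n i * sig q v n j = sig q v n j * sig q v n i := by
  rw [sig_of_lt q v hi, sig_of_lt q v hj]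
  simpa [sigma] using RingQuot.mkAlgHom_rel K
    (Rel.sigma_comm (q := q) (v := v) i j hi hj hij)

theorem tau_sig_comm {i : ℕ} (h : i + 1 < n) (hi : 0 < i) :
    tau q v n * sig q v n i = sig q v n i * tau q v n := by
  rw [sig_of_lt q v h]
  simpa [sigma, tau] using RingQuot.mkAlgHom_rel K (Rel.tau_comm (q := q) (v := v) i h hi)

theorem tau_braid' (h : 1 < n) :
    tau q v n * sig q v n 0 * tau q v n * sig q v n 0 =
      sig q v n 0 * tau q v n * sig q v n 0 * tau q v n := by
  rw [sig_of_lt q v h]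
  simpa [sigma, tau] using RingQuot.mkAlgHom_rel K (Rel.tau_braid (q := q) (v := v) h)

theorem commute_sig_jm_of_lt {i j : ℕ} (hi : i + 1 < n) (hj : j < i) :
    Commute (sig q v n i) (jm q v n j) := by
  induction j with
  | zero =>
    rw [jm_zero q v (by omega)]
    exact (tau_sig_comm q v hi hj).symm
  | succ j ih =>
    rw [jm_succ q v (by omega)]
    have h : Commute (sig q v n i) (sig q v n j) :=
      (sig_comm q v (by omega : j + 1 < n) hi hj).symm
    exact (h.mul_right (ih (by omega))).mul_right h

theorem commute_sig_jm_of_gt {i j : ℕ} (hj : j < n) (hi : i + 1 < j) :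
    Commute (sig q v n i) (jm q v n j) := by
  induction j with
  | zero => omega
  | succ j ih =>
    rcases Nat.lt_or_ge (i + 1) j with h | h
    · have hc : Commute (sig q v n i) (sig q v n j) :=
        sig_comm q v (by omega : i + 1 < n) hj h
      rw [jm_succ q v hj]
      exact (hc.mul_right (ih (by omega) h)).mul_right hc
    -- The only case that needs the braid relation: it turns σ_i into σ_{i+1}, which commutes with
    -- J_i, and then turns it back.
    · obtain rfl : j = i + 1 := by omega
      have hb := sig_braid q v hj
      have hc : sig q v n (i + 1) * jm q v n i = jm q v n i * sig q v n (i + 1) :=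
        commute_sig_jm_of_lt q v hj (Nat.lt_succ_self i)
      rw [jm_succ q v hj, jm_succ q v (Nat.lt_of_succ_lt hj)]
      set s := sig q v n i
      set t := sig q v n (i + 1)
      set X := jm q v n i
      calc s * (t * (s * X * s) * t) = (s * t * s) * X * (s * t) := by simp only [mul_assoc]
        _ = t * s * (t * X) * (s * t) := by rw [hb]; simp only [mul_assoc]
        _ = t * s * X * (t * s * t) := by rw [hc]; simp only [mul_assoc]
        _ = t * (s * X * s) * t * s := by rw [← hb]; simp only [mul_assoc]

theorem commute_tau_jm {j : ℕ} (hj : j < n) : Commute (tau q v n) (jm q v n j) := by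
  induction j with
  | zero => rw [jm_zero q v hj]
  | succ j ih =>
    rcases Nat.eq_zero_or_pos j with rfl | h
    · rw [jm_succ q v hj, jm_zero q v (by omega)]
      have := tau_braid' q v (by omega : 1 < n)
      simpa [Commute, SemiconjBy, mul_assoc] using this
    · have hc : Commute (tau q v n) (sig q v n j) := tau_sig_comm q v hj h
      rw [jm_succ q v hj]
      exact (hc.mul_right (ih (by omega))).mul_right hc

theorem commute_jm_of_lt {i j : ℕ} (hj : j < n) (hi : i < j) :
    Commute (jm q v n i) (jm q v n j) := by
  induction i with
  | zero =>
    rw [jm_zero q v (by omega)]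
    exact commute_tau_jm q v hj
  | succ i ih =>
    rw [jm_succ q v (by omega)]
    have h := commute_sig_jm_of_gt q v hj hi
    exact (h.mul_left (ih (by omega))).mul_left h

theorem adjoin_generators (hn : 0 < n) :
    Algebra.adjoin K (insert (jm q v n 0) (sig q v n '' {i | i + 1 < n})) = ⊤ := by
  set B := Algebra.adjoin K (insert (jm q v n 0) (sig q v n '' {i | i + 1 < n}))
  rw [eq_top_iff]
  rintro x -
  obtain ⟨y, rfl⟩ := RingQuot.mkAlgHom_surjective K (Rel q v n) x
  have key : ∀ y ∈ Algebra.adjoin K (Set.range (FreeAlgebra.ι K (X := Gen n))),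
      RingQuot.mkAlgHom K (Rel q v n) y ∈ B := by
    intro y hy
    induction hy using Algebra.adjoin_induction with
    | mem x hx =>
      obtain ⟨g, rfl⟩ := hx
      cases g with
      | tau =>
        have : jm q v n 0 ∈ B := Algebra.subset_adjoin (Set.mem_insert _ _)
        rwa [jm_zero q v hn] at this
      | sigma i h =>
        have : sig q v n i ∈ B :=
          Algebra.subset_adjoin (Set.mem_insert_of_mem _ ⟨i, h, rfl⟩)
        rwa [sig_of_lt q v h] at this
    | algebraMap r => rw [AlgHom.commutes]; exact B.algebraMap_mem r
    | add x y _ _ hx hy => rw [map_add]; exact B.add_mem hx hy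
    | mul x y _ _ hx hy => rw [map_mul]; exact B.mul_mem hx hy
  exact key y (by rw [FreeAlgebra.adjoin_range_ι]; trivial)

theorem isJMSystem (hn : 0 < n) : IsJMSystem q v n (sig q v n) (jm q v n) where
  quad _ h := sig_quad q v h
  braid _ h := sig_braid q v h
  s_comm _ _ hi hj hij := sig_comm q v hi hj hij
  J_succ _ h := jm_succ q v h
  s_J i j hi hj h1 h2 := by
    rcases Nat.lt_or_ge j i with h | h
    · exact commute_sig_jm_of_lt q v hi h
    · exact commute_sig_jm_of_gt q v hj (by omega)
  J_comm i j hi hj := by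
    rcases lt_trichotomy i j with h | rfl | h
    · exact commute_jm_of_lt q v hj h
    · rfl
    · exact (commute_jm_of_lt q v hi h).symm
  cyclotomic := by
    have := RingQuot.mkAlgHom_rel K (Rel.cyclotomic (q := q) (v := v) (n := n))
    rwa [← Polynomial.aeval_algHom_apply, map_zero, ← tau, ← jm_zero q v hn] at this
  generate := adjoin_generators q v hn

end Relations

/-! ### Intertwiners of consecutive Jucys–Murphy elements -/

section Intertwiner

variable {K A : Type*} [Field K] [Ring A] [Algebra K A] {m : ℕ}

/-- The intertwining element `σ (X - Y) + (q - q⁻¹) Y`, where `X`, `Y` are consecutive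
Jucys–Murphy elements. -/
def inter (q : K) (s J : ℕ → A) (i : ℕ) : A :=
  s i * (J i - J (i + 1)) + (q - q⁻¹) • J (i + 1)

variable {q : K} {v : Fin m → K} {n : ℕ} {s J : ℕ → A}

namespace IsJMSystem



theorem J_mul_s (hS : IsJMSystem q v n s J) {i : ℕ} (hi : i + 1 < n) :
    J i * s i = s i * J (i + 1) - (q - q⁻¹) • J (i + 1) := by
  have h : s i * J (i + 1) = (q - q⁻¹) • J (i + 1) + J i * s i := by
    rw [hS.J_succ i hi, mul_assoc (s i) (J i), ← mul_assoc (s i) (s i), hS.quad i hi, add_mul,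
      one_mul, smul_mul_assoc]
  rw [h]; abel

theorem J_succ_mul_s (hS : IsJMSystem q v n s J) {i : ℕ} (hi : i + 1 < n) :
    J (i + 1) * s i = (q - q⁻¹) • J (i + 1) + s i * J i := by
  rw [hS.J_succ i hi, mul_assoc _ (s i) (s i), hS.quad i hi, mul_add, mul_one, mul_smul_comm]

theorem inter_mul_J (hS : IsJMSystem q v n s J) {i : ℕ} (hi : i + 1 < n) :
    inter q s J i * J i = J (i + 1) * inter q s J i := by
  have hc := hS.J_comm i (i + 1) (by omega) hi
  rw [inter, mul_add, ← mul_assoc (J (i + 1)), hS.J_succ_mul_s hi]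
  simp only [mul_sub, add_mul, sub_mul, smul_mul_assoc, mul_smul_comm, mul_assoc, hc]
  abel

theorem inter_mul_J_succ (hS : IsJMSystem q v n s J) {i : ℕ} (hi : i + 1 < n) :
    inter q s J i * J (i + 1) = J i * inter q s J i := by
  have hc := hS.J_comm i (i + 1) (by omega) hi
  rw [inter, mul_add, ← mul_assoc (J i), hS.J_mul_s hi]
  simp only [mul_sub, add_mul, sub_mul, smul_mul_assoc, mul_smul_comm, mul_assoc, hc]
  abel

theorem inter_mul_J_of_ne (hS : IsJMSystem q v n s J) {i j : ℕ} (hi : i + 1 < n) (hj : j < n)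
    (h1 : j ≠ i)
    (h2 : j ≠ i + 1) : inter q s J i * J j = J j * inter q s J i := by
  have h3 := hS.s_J i j hi hj h1 h2
  have h4 := hS.J_comm i j (by omega) hj
  have h5 := hS.J_comm (i + 1) j hi hj
  rw [inter, mul_add, ← mul_assoc (J j), ← h3]
  simp only [mul_sub, add_mul, sub_mul, smul_mul_assoc, mul_smul_comm, mul_assoc, h4, h5]

/-- The square involves the Jucys–Murphy elements only, so on common eigenvectors it is a scalar;
the two factors show exactly when the intertwiner can fail to be invertible. -/
theorem inter_mul_inter (hS : IsJMSystem q v n s J) (hq : q ≠ 0) {i : ℕ} (hi : i + 1 < n) :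
    inter q s J i * inter q s J i =
      -((J (i + 1) - (q ^ 2) • J i) * (J (i + 1) - (q ^ 2)⁻¹ • J i)) := by
  have hc := hS.J_comm i (i + 1) (by omega) hi
  have h1 : inter q s J i * s i =
      J (i + 1) - J i - (q - q⁻¹) • (s i * J (i + 1)) + (q - q⁻¹) ^ 2 • J (i + 1) := by
    have h2 : (J i - J (i + 1)) * s i =
        s i * (J (i + 1) - J i) - (2 * (q - q⁻¹)) • J (i + 1) := by
      rw [sub_mul, hS.J_mul_s hi, hS.J_succ_mul_s hi, mul_sub, two_mul, add_smul]; abel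
    rw [inter, add_mul, mul_assoc, h2, mul_sub, ← mul_assoc, hS.quad i hi, smul_mul_assoc,
      hS.J_succ_mul_s hi]
    simp only [mul_sub, add_mul, smul_mul_assoc, mul_smul_comm, smul_add, one_mul]
    module
  have h3 : inter q s J i * inter q s J i =
      inter q s J i * s i * (J i - J (i + 1)) + (q - q⁻¹) • (inter q s J i * J (i + 1)) := by
    conv_lhs => rw [inter]
    conv_rhs => rw [mul_assoc, ← mul_smul_comm, ← mul_add]
    rw [← inter]
  rw [h3, h1, inter]
  simp only [mul_sub, add_mul, sub_mul, smul_mul_assoc, mul_smul_comm, mul_assoc, hc, smul_sub,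
    smul_add]
  match_scalars <;> field_simp <;> ring

end IsJMSystem

end Intertwiner

/-! ### Combinatorics of content strings -/

section ContentStrings

variable {K : Type*} [Field K] {m : ℕ}

/-- `c` may be appended to the string `a 0, …, a (k - 1)`, as an eigenvalue of the next
Jucys–Murphy element. -/
def Appendable (q : K) (v : Fin m → K) (k : ℕ) (a : ℕ → K) (c : K) : Prop :=
  ((∃ j, c = v j) ∨ ∃ p < k, a p = q ^ 2 * c ∨ c = q ^ 2 * a p) ∧
    ∀ i < k, a i = c →
      (∃ p, i < p ∧ p < k ∧ a p = q ^ 2 * c) ∧ ∃ p, i < p ∧ p < k ∧ c = q ^ 2 * a p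

/-- The first `k` terms of `a` form a content string. -/
def IsContentString (q : K) (v : Fin m → K) (k : ℕ) (a : ℕ → K) : Prop :=
  ∀ i < k, Appendable q v i a (a i)

variable {q : K} {v : Fin m → K}

theorem IsContentString.mono {k l : ℕ} {a : ℕ → K} (h : IsContentString q v k a) (hl : l ≤ k) :
    IsContentString q v l a := fun i hi => h i (hi.trans_le hl)

theorem Appendable.congr {k : ℕ} {a b : ℕ → K} {c : K} (h : Appendable q v k a c)
    (hab : ∀ i < k, a i = b i) : Appendable q v k b c := by
  refine ⟨h.1.imp id ?_, fun i hi hc => ?_⟩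
  · rintro ⟨p, hp, h⟩
    exact ⟨p, hp, by rwa [← hab p hp]⟩
  · obtain ⟨⟨p, h1, h2, h3⟩, p', h4, h5, h6⟩ := h.2 i hi (by rw [hab i hi, hc])
    exact ⟨⟨p, h1, h2, by rwa [← hab p h2]⟩, p', h4, h5, by rwa [← hab p' h5]⟩

theorem IsContentString.ne_zero {k : ℕ} {a : ℕ → K} (h : IsContentString q v k a)
    (hq : q ≠ 0) (hv : ∀ j, v j ≠ 0) {i : ℕ} (hi : i < k) : a i ≠ 0 := by
  induction i using Nat.strong_induction_on with
  | _ i ih =>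
    rcases (h i hi).1 with ⟨j, hj⟩ | ⟨p, hp, hp' | hp'⟩
    · rw [hj]; exact hv j
    · intro h0
      exact ih p hp (hp.trans hi) (by rw [hp', h0, mul_zero])
    · rw [hp']
      exact mul_ne_zero (pow_ne_zero _ hq) (ih p hp (hp.trans hi))

/-- An entry of a content string is connected with some `v j` through entries of the string. -/
theorem IsContentString.connected (hq : q ≠ 0) {k : ℕ} {a : ℕ → K}
    (h : IsContentString q v k a) {i : ℕ} (hi : i < k) :
    (∃ (j : Fin m) (L : ℕ), a i = v j * (q ^ 2) ^ L ∧
        ∀ t ≤ L, ∃ p < k, a p = v j * (q ^ 2) ^ t) ∨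
      ∃ (j : Fin m) (L : ℕ), a i * (q ^ 2) ^ L = v j ∧
        ∀ t ≤ L, ∃ p < k, a p * (q ^ 2) ^ t = v j := by
  have hQ : q ^ 2 ≠ 0 := pow_ne_zero _ hq
  induction i using Nat.strong_induction_on with
  | _ i ih =>
    rcases (h i hi).1 with ⟨j, hj⟩ | ⟨p, hp, hp' | hp'⟩
    · refine Or.inl ⟨j, 0, by simpa using hj, fun t ht => ⟨i, hi, ?_⟩⟩
      obtain rfl : t = 0 := by omega
      simpa using hj
    · rcases ih p hp (hp.trans hi) with ⟨j, L, h1, h2⟩ | ⟨j, L, h1, h2⟩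
      · cases L with
        | zero =>
          refine Or.inr ⟨j, 1, ?_, fun t ht => ?_⟩
          · rw [pow_one, mul_comm, ← hp', h1, pow_zero, mul_one]
          · rcases (by omega : t = 0 ∨ t = 1) with rfl | rfl
            · obtain ⟨p', h3, h4⟩ := h2 0 le_rfl
              exact ⟨p', h3, by rw [h4]; ring⟩
            · exact ⟨i, hi, by rw [pow_one, mul_comm, ← hp', h1, pow_zero, mul_one]⟩
        | succ L =>
          refine Or.inl ⟨j, L, ?_, fun t ht => h2 t (by omega)⟩
          apply mul_left_cancel₀ hQ
          rw [← hp', h1]; ring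
      · have h3 : a i * (q ^ 2) ^ (L + 1) = v j := by rw [← h1, hp']; ring
        refine Or.inr ⟨j, L + 1, h3, fun t ht => ?_⟩
        rcases Nat.lt_or_ge L t with h4 | h4
        · obtain rfl : t = L + 1 := by omega
          exact ⟨i, hi, h3⟩
        · exact h2 t h4
    · rcases ih p hp (hp.trans hi) with ⟨j, L, h1, h2⟩ | ⟨j, L, h1, h2⟩
      · have h3 : a i = v j * (q ^ 2) ^ (L + 1) := by rw [hp', h1]; ring
        refine Or.inl ⟨j, L + 1, h3, fun t ht => ?_⟩
        rcases Nat.lt_or_ge L t with h4 | h4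
        · obtain rfl : t = L + 1 := by omega
          exact ⟨i, hi, h3⟩
        · exact h2 t h4
      · cases L with
        | zero =>
          refine Or.inl ⟨j, 1, ?_, fun t ht => ?_⟩
          · rw [hp', ← h1]; ring
          · rcases (by omega : t = 0 ∨ t = 1) with rfl | rfl
            · obtain ⟨p', h3, h4⟩ := h2 0 le_rfl
              exact ⟨p', h3, by rw [← h4]; ring⟩
            · exact ⟨i, hi, by rw [hp', ← h1]; ring⟩
        | succ L =>
          refine Or.inr ⟨j, L, ?_, fun t ht => h2 t (by omega)⟩
          rw [hp', ← h1]; ring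

/-- If neither `c` nor `q ^ 2 * c` occurs yet, a chain from some `v j` can only arrive at `c` from
below, and all its earlier members are already in the string. -/
theorem Appendable.connected_down (hq : q ≠ 0) {k : ℕ} {a : ℕ → K} {c : K}
    (h : IsContentString q v k a) (hc : Appendable q v k a c)
    (h1 : ∀ i < k, a i ≠ c) (h2 : ∀ i < k, a i ≠ q ^ 2 * c) :
    ∃ (j : Fin m) (L : ℕ), c = v j * (q ^ 2) ^ L ∧ ∀ t < L, ∃ p < k, a p = v j * (q ^ 2) ^ t := by
  rcases hc.1 with ⟨j, hj⟩ | ⟨p, hp, hp' | hp'⟩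
  · exact ⟨j, 0, by simpa using hj, fun t ht => absurd ht (by omega)⟩
  · exact absurd hp' (h2 p hp)
  · rcases h.connected hq hp with ⟨j, L, h3, h4⟩ | ⟨j, L, h3, h4⟩
    · exact ⟨j, L + 1, by rw [hp', h3]; ring, fun t ht => h4 t (by omega)⟩
    · cases L with
      | zero =>
        refine ⟨j, 1, by rw [hp', ← h3]; ring, fun t ht => ?_⟩
        obtain rfl : t = 0 := by omega
        obtain ⟨p', h5, h6⟩ := h4 0 le_rfl
        exact ⟨p', h5, by rw [← h6]; ring⟩
      | succ L =>
        obtain ⟨p', h5, h6⟩ := h4 L (by omega)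
        refine absurd ?_ (h1 p' h5)
        apply mul_right_cancel₀ (pow_ne_zero L (pow_ne_zero 2 hq))
        rw [h6, ← h3, hp']; ring

/-- The mirror image of `Appendable.connected_down`: the chain arrives at `q ^ 2 * c` from above. -/
theorem Appendable.connected_up (hq : q ≠ 0) {k : ℕ} {a : ℕ → K} {c : K}
    (h : IsContentString q v k a) (hc : Appendable q v k a (q ^ 2 * c))
    (h1 : ∀ i < k, a i ≠ c) (h2 : ∀ i < k, a i ≠ q ^ 2 * c) :
    ∃ (j : Fin m) (L : ℕ), q ^ 2 * c * (q ^ 2) ^ L = v j ∧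
      ∀ t < L, ∃ p < k, a p * (q ^ 2) ^ t = v j := by
  have hQ : q ^ 2 ≠ 0 := pow_ne_zero _ hq
  rcases hc.1 with ⟨j, hj⟩ | ⟨p, hp, hp' | hp'⟩
  · exact ⟨j, 0, by simpa using hj, fun t ht => absurd ht (by omega)⟩
  · rcases h.connected hq hp with ⟨j, L, h3, h4⟩ | ⟨j, L, h3, h4⟩
    · cases L with
      | zero =>
        refine ⟨j, 1, by rw [pow_zero, mul_one] at h3; rw [← h3, hp']; ring, fun t ht => ?_⟩
        obtain rfl : t = 0 := by omega
        obtain ⟨p', h5, h6⟩ := h4 0 le_rfl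
        exact ⟨p', h5, by rw [h6]; ring⟩
      | succ L =>
        obtain ⟨p', h5, h6⟩ := h4 L (by omega)
        refine absurd ?_ (h2 p' h5)
        apply mul_left_cancel₀ hQ
        rw [h6, ← hp', h3]; ring
    · exact ⟨j, L + 1, by rw [← h3, hp']; ring, fun t ht => h4 t (by omega)⟩
  · exact absurd (mul_left_cancel₀ hQ hp').symm (h1 p hp)

/-- `c` and `q² c` cannot both be appended to a content string. -/
theorem not_appendable_both {n : ℕ} (hP : SemisimpleOver q v n) {k : ℕ} (hk : k + 2 ≤ n)
    {a : ℕ → K} {c : K} (h : IsContentString q v k a) (hc : Appendable q v k a c)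
    (hc' : Appendable q v k a (q ^ 2 * c)) : False := by
  have hq := hP.q_ne_zero
  have hQ : q ^ 2 ≠ 0 := pow_ne_zero _ hq
  have hone := hP.pow_ne_one (by omega)
  -- Neither value occurs: an occurrence of `c` forces a later `q ^ 2 * c`, which forces a later
  -- `c`, and so on beyond the end. Here `d` bounds the distance to the end.
  have hnot : ∀ d, ∀ i < k, k ≤ i + d → ¬ (a i = c ∨ a i = q ^ 2 * c) := by
    intro d
    induction d with
    | zero => intro i hi hd; omega
    | succ d ih =>
      rintro i hi hd (h1 | h1)
      · obtain ⟨⟨p, hp1, hp2, hp3⟩, -⟩ := hc.2 i hi h1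
        exact ih p hp2 (by omega) (Or.inr hp3)
      · obtain ⟨-, p, hp1, hp2, hp3⟩ := hc'.2 i hi h1
        exact ih p hp2 (by omega) (Or.inl (mul_left_cancel₀ hQ hp3).symm)
  have h1 : ∀ i < k, a i ≠ c := fun i hi h => hnot k i hi (by omega) (Or.inl h)
  have h2 : ∀ i < k, a i ≠ q ^ 2 * c := fun i hi h => hnot k i hi (by omega) (Or.inr h)
  obtain ⟨j, L, h3, h4⟩ := hc.connected_down hq h h1 h2
  obtain ⟨j', L', h5, h6⟩ := hc'.connected_up hq h h1 h2
  have hv := hP.v_ne_zero j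
  have h7 : v j * (q ^ 2) ^ (L + L' + 1) = v j' := by rw [← h5, h3]; ring
  -- The two chains join into one from `v j` to `v j'`, of which only the exponents `L` and `L + 1`,
  -- the values `c` and `q ^ 2 * c`, are missing.
  have hmem : ∀ u ≤ L + L' + 1, u ≠ L → u ≠ L + 1 → ∃ p < k, a p = v j * (q ^ 2) ^ u := by
    intro u hu hu1 hu2
    rcases Nat.lt_or_ge u L with h8 | h8
    · exact h4 u h8
    · obtain ⟨p, hp, hp'⟩ := h6 (L + L' + 1 - u) (by omega)
      refine ⟨p, hp, mul_right_cancel₀ (pow_ne_zero (L + L' + 1 - u) hQ) ?_⟩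
      rw [hp', ← h7, mul_assoc, ← pow_add]
      congr 2
      omega
  have hlen : L + L' + 1 < n := by
    by_contra hlen
    -- A window of `n + 1` consecutive exponents around the two missing ones. The other `n - 1`
    -- values all occur among `k ≤ n - 2` entries, so two coincide and a power of `q ^ 2` with
    -- exponent between 1 and `n` equals 1.
    obtain ⟨w, hw1, hw2, hw3⟩ : ∃ w, w ≤ L ∧ L + 1 ≤ w + n ∧ w + n ≤ L + L' + 1 :=
      ⟨L + 1 - min (L + 1) n, by omega, by omega, by omega⟩
    let S := ((Finset.Icc w (w + n)).erase L).erase (L + 1)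
    have hcard : (Finset.range k).card < S.card := by
      rw [Finset.card_erase_of_mem, Finset.card_erase_of_mem, Nat.card_Icc, Finset.card_range]
      · omega
      · simp; omega
      · simp; omega
    have hS : ∀ u ∈ S, ∃ p < k, a p = v j * (q ^ 2) ^ u := by
      intro u hu
      simp only [S, Finset.mem_erase, Finset.mem_Icc] at hu
      exact hmem u (by omega) hu.2.1 hu.1
    choose! f hf1 hf2 using hS
    obtain ⟨x, hx, y, hy, hxy, hfxy⟩ := Finset.exists_ne_map_eq_of_card_lt_of_maps_to hcard
      (f := f) (fun u hu => by simpa using hf1 u hu)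
    have key : ∀ x ∈ S, ∀ y ∈ S, x < y → f x = f y → False := by
      intro x hx y hy hxy hf
      have h8 : (q ^ 2) ^ x = (q ^ 2) ^ y := by
        apply mul_left_cancel₀ hv
        rw [← hf2 x hx, ← hf2 y hy, hf]
      simp only [S, Finset.mem_erase, Finset.mem_Icc] at hx hy
      refine hone (y - x) (by omega) (by omega) (mul_left_cancel₀ (pow_ne_zero x hQ) ?_)
      rw [← pow_add, mul_one, h8]
      congr 1
      omega
    rcases lt_or_gt_of_ne hxy with h8 | h8
    · exact key x hx y hy h8 hfxy
    · exact key y hy x hx h8 hfxy.symm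
  by_cases hj : j = j'
  · subst hj
    exact hone (L + L' + 1) (by omega) hlen.le (mul_left_cancel₀ hv (by rw [h7, mul_one]))
  · exact hP.pow_mul_ne _ hlen j j' hj h7

end ContentStrings

/-! ### Diagonalizability without finite dimension -/

section Eigenvectors

variable {K A V : Type*} [Field K] [Ring A] [Algebra K A] [AddCommGroup V] [Module K V]
  [Module A V] [IsScalarTower K A V]

open Polynomial in
theorem aeval_smul_of_smul_eq {T : A} {x : V} {c : K} (h : T • x = c • x) (p : K[X]) :
    aeval T p • x = p.eval c • x := by
  induction p using Polynomial.induction_on' with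
  | add p r hp hr => rw [map_add, add_smul, hp, hr, eval_add, add_smul]
  | monomial k r =>
    have hk : ∀ k : ℕ, T ^ k • x = c ^ k • x := by
      intro k
      induction k with
      | zero => simp
      | succ k ih => rw [pow_succ, mul_smul, h, smul_comm, ih, smul_smul, pow_succ']
    rw [aeval_monomial, mul_smul, hk, eval_monomial, mul_smul, algebraMap_smul]

/-- `T` has no nilpotent part on the vector `z`. -/
def SemisimpleAt (T : A) (z : V) : Prop :=
  ∀ d : K, T • (T • z - d • z) = d • (T • z - d • z) → T • z = d • z

-- Absence of Jordan blocks and an annihilating product of linear factors give an eigenvector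
-- decomposition. Keeping the summands of the form `r • y` with `r` in `B` is what later decomposes
-- the unit of the algebra inside K[J].
open Polynomial in
theorem mem_span_eigenvectors (B : Subalgebra K A) {T : A} (hT : T ∈ B) (l : List K) (y : V)
    (hN : ∀ r ∈ B, SemisimpleAt (K := K) T (r • y))
    (h : aeval T (l.map fun c => X - C c).prod • y = 0) :
    y ∈ Submodule.span K {z : V | (∃ r ∈ B, z = r • y) ∧ ∃ e : K, T • z = e • z} := by
  induction l generalizing y with
  | nil =>
    have hy : y = 0 := by simpa using h
    rw [hy]; exact Submodule.zero_mem _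
  | cons c l ih =>
    set E := {z : V | (∃ r ∈ B, z = r • y) ∧ ∃ e : K, T • z = e • z}
    have hTc : T - algebraMap K A c ∈ B := B.sub_mem hT (B.algebraMap_mem c)
    have hsub : ∀ z : V, (T - algebraMap K A c) • z = T • z - c • z := fun z => by
      rw [sub_smul, algebraMap_smul]
    have h1 : (T - algebraMap K A c) • y ∈ Submodule.span K E := by
      refine Submodule.span_mono ?_ (ih ((T - algebraMap K A c) • y) ?_ ?_)
      · rintro z ⟨⟨r, hr, rfl⟩, he⟩
        exact ⟨⟨r * (T - algebraMap K A c), B.mul_mem hr hTc, (mul_smul _ _ _).symm⟩, he⟩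
      · intro r hr
        rw [← mul_smul]
        exact hN _ (B.mul_mem hr hTc)
      · rw [List.map_cons, List.prod_cons, mul_comm, map_mul, mul_smul] at h
        simpa using h
    -- On a span of eigenvectors, `T - c` is invertible on the eigenvalues other than `c`, so every
    -- vector is in its image up to an element of its kernel. Applied to `(T - c) y`, this gives `(T
    -- - c)² (y - u) = 0`.
    have h2 : ∀ y' ∈ Submodule.span K E, ∃ u ∈ Submodule.span K E,
        (T - algebraMap K A c) • (y' - (T - algebraMap K A c) • u) = 0 := by
      intro y' hy'
      induction hy' using Submodule.span_induction with
      | mem z hz =>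
        obtain ⟨-, e, he⟩ := id hz
        by_cases hec : e = c
        · refine ⟨0, Submodule.zero_mem _, ?_⟩
          rw [smul_zero, sub_zero, hsub, he, hec, sub_self]
        · refine ⟨(e - c)⁻¹ • z, Submodule.smul_mem _ _ (Submodule.subset_span hz), ?_⟩
          rw [smul_comm, hsub z, he, ← sub_smul, smul_smul, inv_mul_cancel₀ (sub_ne_zero.2 hec),
            one_smul, sub_self, smul_zero]
      | zero => exact ⟨0, Submodule.zero_mem _, by simp⟩
      | add a b _ _ ha hb =>
        obtain ⟨u, hu, hu'⟩ := ha
        obtain ⟨w, hw, hw'⟩ := hb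
        refine ⟨u + w, Submodule.add_mem _ hu hw, ?_⟩
        rw [smul_add, add_sub_add_comm, smul_add, hu', hw', add_zero]
      | smul k a _ ha =>
        obtain ⟨u, hu, hu'⟩ := ha
        refine ⟨k • u, Submodule.smul_mem _ _ hu, ?_⟩
        rw [smul_comm _ k u, ← smul_sub, smul_comm _ k, hu', smul_zero]
    obtain ⟨u, hu, hu'⟩ := h2 _ h1
    have h3 : ∀ y' ∈ Submodule.span K E, ∃ r ∈ B, y' = r • y := by
      intro y' hy'
      induction hy' using Submodule.span_induction with
      | mem z hz => exact hz.1
      | zero => exact ⟨0, B.zero_mem, by simp⟩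
      | add a b _ _ ha hb =>
        obtain ⟨r, hr, rfl⟩ := ha
        obtain ⟨r', hr', rfl⟩ := hb
        exact ⟨r + r', B.add_mem hr hr', (add_smul _ _ _).symm⟩
      | smul k a _ ha =>
        obtain ⟨r, hr, rfl⟩ := ha
        exact ⟨k • r, B.smul_mem hr k, (smul_assoc _ _ _).symm⟩
    obtain ⟨r, hr, hru⟩ := h3 u hu
    have hw : y - u = (1 - r) • y := by rw [sub_smul, one_smul, ← hru]
    have h4 : T • (y - u) = c • (y - u) := by
      rw [hw]
      refine hN _ (B.sub_mem B.one_mem hr) c ?_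
      rw [← hw, ← sub_eq_zero, ← hsub, ← hsub, ← hu']
      simp only [smul_sub]
    rw [← sub_add_cancel y u]
    exact Submodule.add_mem _ (Submodule.subset_span ⟨⟨_, B.sub_mem B.one_mem hr, hw⟩, c, h4⟩) hu

open Polynomial in
theorem exists_list_of_mem_span {T : A} {y : V} {E : Set V}
    (hE : ∀ z ∈ E, ∃ e : K, T • z = e • z) (hy : y ∈ Submodule.span K E) :
    ∃ l : List K, aeval T (l.map fun c => X - C c).prod • y = 0 := by
  induction hy using Submodule.span_induction with
  | mem z hz =>
    obtain ⟨e, he⟩ := hE z hz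
    exact ⟨[e], by simp [sub_smul, he]⟩
  | zero => exact ⟨[], by simp⟩
  | add a b _ _ ha hb =>
    obtain ⟨l, hl⟩ := ha
    obtain ⟨l', hl'⟩ := hb
    refine ⟨l ++ l', ?_⟩
    rw [List.map_append, List.prod_append, smul_add, map_mul, mul_smul _ _ b, hl', smul_zero,
      ← map_mul, mul_comm, map_mul, mul_smul, hl, smul_zero, add_zero]
  | smul k a _ ha =>
    obtain ⟨l, hl⟩ := ha
    exact ⟨l, by rw [smul_comm, hl, smul_zero]⟩

-- Distinct roots make `X - d` coprime to a cofactor `R` for which the annihilating polynomial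
-- divides `(X - d) R`; hence `(T - d)²` and `T - d` have the same kernel.
open Polynomial in
theorem semisimpleAt_of_separable {T : A} {ι : Type*} [Fintype ι] (v : ι → K)
    (hv : Function.Injective v) (hT : aeval T (∏ j, (X - C (v j))) = 0) (z : V) :
    SemisimpleAt (K := K) T z := by
  intro d hd
  set P : K[X] := ∏ j, (X - C (v j)) with hP
  have hsub : ∀ z : V, aeval T (X - C d) • z = T • z - d • z := fun z => by
    simp [sub_smul]
  rw [← sub_eq_zero, ← hsub, ← hsub] at hd
  rw [← sub_eq_zero, ← hsub]
  have hcop : ∃ R : K[X], IsCoprime (X - C d) R ∧ P ∣ (X - C d) * R := by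
    by_cases hdv : ∃ j, v j = d
    · obtain ⟨j, rfl⟩ := hdv
      classical
      refine ⟨∏ i ∈ Finset.univ.erase j, (X - C (v i)), IsCoprime.prod_right fun i hi => ?_, ?_⟩
      · exact isCoprime_X_sub_C_of_isUnit_sub
          (sub_ne_zero.2 fun h => (Finset.ne_of_mem_erase hi) (hv h).symm).isUnit
      · rw [Finset.mul_prod_erase _ (fun i => X - C (v i)) (Finset.mem_univ j)]
    · push Not at hdv
      exact ⟨P, IsCoprime.prod_right fun i _ => isCoprime_X_sub_C_of_isUnit_sub
        (sub_ne_zero.2 (hdv i).symm).isUnit, dvd_mul_left _ _⟩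
  obtain ⟨R, ⟨a, b, hab⟩, S, hS⟩ := hcop
  have h1 : (X - C d : K[X]) = a * ((X - C d) * (X - C d)) + b * (P * S) := by
    rw [← hS]; linear_combination (-(X - C d)) * hab
  rw [h1, map_add, map_mul _ a, map_mul _ (X - C d) (X - C d), map_mul _ b, map_mul _ P, hT,
    zero_mul, mul_zero, add_zero, mul_smul, mul_smul, hd, smul_zero]

/-- `x` is a common eigenvector of `J 0, …, J (k - 1)` with eigenvalues `a 0, …, a (k - 1)`. -/
def IsEig (J : ℕ → A) (k : ℕ) (a : ℕ → K) (x : V) : Prop :=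
  ∀ i < k, J i • x = a i • x

/-- The subalgebra generated by `J 0, …, J (n - 1)`. -/
def jmAlg (K : Type*) {A : Type*} [Field K] [Ring A] [Algebra K A] (J : ℕ → A) (n : ℕ) :
    Subalgebra K A :=
  Algebra.adjoin K (J '' {i | i < n})

theorem J_mem_jmAlg {J : ℕ → A} {n i : ℕ} (hi : i < n) : J i ∈ jmAlg K J n :=
  Algebra.subset_adjoin ⟨i, hi, rfl⟩

/-- Every vector is a combination of common eigenvectors of `J 0, …, J (k - 1)` that are obtained
from it by elements of the algebra generated by the `J i`. -/
def JDiagonalizable (K : Type*) {A : Type*} [Field K] [Ring A] [Algebra K A] (J : ℕ → A)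
    (n k : ℕ) (V : Type*) [AddCommGroup V] [Module K V] [Module A V] : Prop :=
  ∀ y : V, y ∈ Submodule.span K
    {z : V | (∃ r ∈ jmAlg K J n, z = r • y) ∧ ∃ a : ℕ → K, IsEig J k a z}

omit [Algebra K A] [IsScalarTower K A V] in
theorem IsEig.mono {J : ℕ → A} {k l : ℕ} {a : ℕ → K} {x : V} (h : IsEig J k a x) (hl : l ≤ k) :
    IsEig J l a x := fun i hi => h i (hi.trans_le hl)

omit [Algebra K A] [IsScalarTower K A V] in
theorem IsEig.congr {J : ℕ → A} {k : ℕ} {a b : ℕ → K} {x : V} (h : IsEig J k a x)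
    (hab : ∀ i < k, a i = b i) : IsEig J k b x := fun i hi => by rw [h i hi, hab i hi]

omit [Algebra K A] [IsScalarTower K A V] in
theorem IsEig.succ {J : ℕ → A} {k : ℕ} {a : ℕ → K} {x : V} (h : IsEig J k a x) {e : K}
    (he : J k • x = e • x) : IsEig J (k + 1) (Function.update a k e) x := by
  intro i hi
  rcases Nat.lt_or_ge i k with h1 | h1
  · rw [h i h1, Function.update_of_ne h1.ne]
  · obtain rfl : i = k := by omega
    rw [he, Function.update_self]

variable {m n : ℕ} {q : K} {v : Fin m → K} {s J : ℕ → A}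

theorem IsJMSystem.jmAlg_comm (hS : IsJMSystem q v n s J) {x y : A} (hx : x ∈ jmAlg K J n)
    (hy : y ∈ jmAlg K J n) : x * y = y * x := by
  refine Algebra.adjoin_induction₂ (s := J '' {i | i < n}) ?_ ?_ ?_ ?_ ?_ ?_ ?_ ?_ hx hy
  · rintro _ _ ⟨i, hi, rfl⟩ ⟨j, hj, rfl⟩
    exact hS.J_comm i j hi hj
  · intro a b; exact Algebra.commutes a _
  · intro a b _; exact Algebra.commutes a _
  · intro a b _; exact (Algebra.commutes a _).symm
  · intro x y z _ _ _ h1 h2; rw [add_mul, mul_add, h1, h2]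
  · intro x y z _ _ _ h1 h2; rw [add_mul, mul_add, h1, h2]
  · intro x y z _ _ _ h1 h2; rw [mul_assoc, h2, ← mul_assoc, h1, mul_assoc]
  · intro x y z _ _ _ h1 h2; rw [← mul_assoc, h1, mul_assoc, h2, mul_assoc]

theorem IsJMSystem.isEig_smul (hS : IsJMSystem q v n s J) {k : ℕ} (hk : k ≤ n) {a : ℕ → K}
    {x : V} (hx : IsEig J k a x) {r : A} (hr : r ∈ jmAlg K J n) : IsEig J k a (r • x) := by
  intro i hi
  rw [← mul_smul, hS.jmAlg_comm (J_mem_jmAlg (hi.trans_le hk)) hr, mul_smul, hx i hi, smul_comm]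

theorem IsJMSystem.semisimpleAt (hS : IsJMSystem q v n s J) {k : ℕ} (hk : k ≤ n)
    (hD : JDiagonalizable K J n k V) {i : ℕ} (hi : i < k) (y : V) :
    SemisimpleAt (K := K) (J i) y := by
  intro d hd
  have key : ∀ z ∈ {z : V | (∃ r ∈ jmAlg K J n, z = r • y) ∧ ∃ a : ℕ → K, IsEig J k a z},
      J i • z = d • z := by
    rintro z ⟨⟨r, hr, hz⟩, a, ha⟩
    have h1 : J i • (J i • z - d • z) = d • (J i • z - d • z) := by
      have hc := hS.jmAlg_comm (J_mem_jmAlg (K := K) (J := J) (hi.trans_le hk)) hr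
      have h2 : J i • z - d • z = r • (J i • y - d • y) := by
        rw [hz, smul_sub, ← mul_smul, hc, mul_smul, smul_comm d]
      rw [h2, ← mul_smul, hc, mul_smul, hd, smul_comm d]
    have h3 := ha i hi
    rw [h3, ← sub_smul, smul_comm, h3, ← sub_eq_zero, smul_comm d, ← smul_sub, ← sub_smul,
      smul_smul, smul_eq_zero, mul_self_eq_zero, sub_eq_zero] at h1
    rcases h1 with h1 | h1
    · rw [h3, h1]
    · rw [h1, smul_zero, smul_zero]
  refine (?_ : ∀ y' ∈ Submodule.span K _, J i • y' = d • y') y (hD y)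
  intro y' hy
  induction hy using Submodule.span_induction with
  | mem z hz => exact key z hz
  | zero => simp
  | add a b _ _ ha hb => rw [smul_add, smul_add, ha, hb]
  | smul k a _ ha => rw [smul_comm, ha, smul_comm]

end Eigenvectors

/-! ### Action of intertwiners on eigenvectors; forbidden patterns -/

section Spectrum

variable {K A V : Type*} [Field K] [Ring A] [Algebra K A] [AddCommGroup V] [Module K V]
  [Module A V] [IsScalarTower K A V]
  {m n : ℕ} {q : K} {v : Fin m → K} {s J : ℕ → A}

/-- `c` and `d` are different and not neighbours in a string of contents. -/
def Separated (q c d : K) : Prop := c ≠ d ∧ c ≠ q ^ 2 * d ∧ d ≠ q ^ 2 * c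

theorem Separated.symm {c d : K} (h : Separated q c d) : Separated q d c :=
  ⟨h.1.symm, h.2.2, h.2.1⟩

theorem inter_smul {i : ℕ} {c d : K} {x : V}
    (hc : J i • x = c • x) (hd : J (i + 1) • x = d • x) :
    inter q s J i • x = (c - d) • s i • x + ((q - q⁻¹) * d) • x := by
  rw [inter, add_smul, mul_smul, sub_smul, hc, hd, smul_assoc, hd, ← sub_smul, smul_comm,
    smul_smul]

namespace IsJMSystem

theorem inter_inter_smul (hS : IsJMSystem q v n s J) (hq : q ≠ 0) {i : ℕ} (hi : i + 1 < n)
    {c : K} {x : V} (hc : J i • x = c • x) :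
    inter q s J i • inter q s J i • x =
      -((J (i + 1) - algebraMap K A (q ^ 2 * c)) •
        (J (i + 1) - algebraMap K A ((q ^ 2)⁻¹ * c)) • x) := by
  have h1 : J i • J (i + 1) • x = c • J (i + 1) • x := by
    rw [← mul_smul, hS.J_comm _ _ (by omega) hi, mul_smul, hc, smul_comm]
  have h2 : ∀ (z : V) (r : K), J i • z = c • z →
      (J (i + 1) - r • J i) • z = (J (i + 1) - algebraMap K A (r * c)) • z := by
    intro z r hz
    rw [sub_smul, sub_smul, smul_assoc, hz, algebraMap_smul, smul_smul]
  rw [← mul_smul, hS.inter_mul_inter hq hi, neg_smul, mul_smul, h2 x _ hc, h2]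
  rw [sub_smul, smul_sub, h1, algebraMap_smul, smul_comm (J i) _ x, hc, smul_sub,
    smul_comm c ((q ^ 2)⁻¹ * c) x]

theorem inter_inter_smul' (hS : IsJMSystem q v n s J) (hq : q ≠ 0) {i : ℕ} (hi : i + 1 < n)
    {c d : K} {x : V} (hc : J i • x = c • x) (hd : J (i + 1) • x = d • x) :
    inter q s J i • inter q s J i • x =
      (-((d - q ^ 2 * c) * (d - (q ^ 2)⁻¹ * c))) • x := by
  rw [hS.inter_inter_smul hq hi hc, sub_smul (J (i + 1)) _ x, hd, algebraMap_smul, ← sub_smul,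
    smul_comm, sub_smul (J (i + 1)) _ x, hd, algebraMap_smul, ← sub_smul, smul_smul, neg_smul,
    mul_comm]

theorem inter_smul_ne_zero (hS : IsJMSystem q v n s J) (hq : q ≠ 0) {i : ℕ} (hi : i + 1 < n)
    {c d : K} {x : V} (hx : x ≠ 0) (hc : J i • x = c • x) (hd : J (i + 1) • x = d • x)
    (hcd : c ≠ q ^ 2 * d) (hdc : d ≠ q ^ 2 * c) : inter q s J i • x ≠ 0 := by
  intro h
  have h1 := hS.inter_inter_smul' hq hi hc hd
  rw [h, smul_zero, eq_comm, smul_eq_zero, neg_eq_zero, mul_eq_zero, sub_eq_zero,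
    sub_eq_zero] at h1
  rcases h1 with (h1 | h1) | h1
  · exact hdc h1
  · exact hcd (by rw [h1, mul_inv_cancel_left₀ (pow_ne_zero 2 hq)])
  · exact hx h1

theorem isEig_inter_smul (hS : IsJMSystem q v n s J) {k : ℕ} (hk : k ≤ n) {i : ℕ}
    (hi : i + 1 < k) {a : ℕ → K} {x : V} (hx : IsEig J k a x) :
    IsEig J k (fun j => a (Equiv.swap i (i + 1) j)) (inter q s J i • x) := by
  intro j hj
  beta_reduce
  rw [← mul_smul]
  by_cases h1 : j = i
  · subst h1
    rw [← hS.inter_mul_J_succ (by omega), mul_smul, hx _ hi, smul_comm, Equiv.swap_apply_left]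
  · by_cases h2 : j = i + 1
    · subst h2
      rw [← hS.inter_mul_J (by omega), mul_smul, hx i (by omega), smul_comm,
        Equiv.swap_apply_right]
    · rw [← hS.inter_mul_J_of_ne (by omega) (by omega) h1 h2, mul_smul, hx j hj, smul_comm,
        Equiv.swap_apply_of_ne_of_ne h1 h2]

/-- With equal eigenvalues, `(J i - c) s i x` is a nonzero multiple of `x`, so `x` and `s i x` would
form a Jordan block of `J i`. Only `J i` is assumed semisimple, because in the induction nothing is
known yet about `J (i + 1)`. -/
theorem eq_zero_of_eq_succ (hS : IsJMSystem q v n s J) (hP : SemisimpleOver q v n) {i : ℕ}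
    (hi : i + 1 < n) (hN : ∀ z : V, SemisimpleAt (K := K) (J i) z) {c : K} (hc0 : c ≠ 0) {x : V}
    (hc : J i • x = c • x) (hc' : J (i + 1) • x = c • x) : x = 0 := by
  have hh : q - q⁻¹ ≠ 0 := fun h => hP.pow_ne_one (by omega) 1 le_rfl (by omega) (by
    rw [sub_eq_zero] at h
    rw [pow_one, sq]
    nth_rewrite 2 [h]
    exact mul_inv_cancel₀ hP.q_ne_zero)
  have h1 : J i • s i • x = c • s i • x - ((q - q⁻¹) * c) • x := by
    rw [← mul_smul, hS.J_mul_s hi, sub_smul, mul_smul, hc', smul_comm, smul_assoc, hc', smul_smul]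
  have h2 := hN (s i • x) c (by
    rw [h1, sub_sub_cancel_left, smul_neg, smul_comm, hc, smul_neg, smul_comm])
  rw [h1, sub_eq_self, smul_eq_zero] at h2
  exact h2.resolve_left (mul_ne_zero hh hc0)

/-- Strings of eigenvalues do not contain `c, e, c` at consecutive places. -/
theorem eq_zero_of_return (hS : IsJMSystem q v n s J) (hP : SemisimpleOver q v n) {i : ℕ}
    (hi : i + 2 < n) (hN : ∀ z : V, SemisimpleAt (K := K) (J i) z)
    (hN' : ∀ z : V, SemisimpleAt (K := K) (J (i + 1)) z) {c e : K} (hc0 : c ≠ 0) (he0 : e ≠ 0)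
    (hce : c ≠ e) (hce' : e + c ≠ 0) {x : V} (h0 : J i • x = c • x)
    (h1 : J (i + 1) • x = e • x) (h2 : J (i + 2) • x = c • x) : x = 0 := by
  have hh : q - q⁻¹ ≠ 0 := fun h => hP.pow_ne_one (by omega) 1 le_rfl (by omega) (by
    rw [sub_eq_zero] at h
    rw [pow_one, sq]
    nth_rewrite 2 [h]
    exact mul_inv_cancel₀ hP.q_ne_zero)
  -- Each intertwiner would create two equal adjacent entries, so both kill `x`. Then `s i` and `s
  -- (i + 1)` act on `x` by scalars, which the braid relation makes incompatible.
  have h3 : inter q s J i • x = 0 := by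
    refine hS.eq_zero_of_eq_succ hP hi hN' hc0 ?_ ?_
    · rw [← mul_smul, ← hS.inter_mul_J (by omega), mul_smul, h0, smul_comm]
    · rw [← mul_smul, ← hS.inter_mul_J_of_ne (by omega) hi (by omega) (by omega), mul_smul, h2,
        smul_comm]
  have h4 : inter q s J (i + 1) • x = 0 := by
    refine hS.eq_zero_of_eq_succ hP (i := i) (by omega) hN hc0 ?_ ?_
    · rw [← mul_smul, ← hS.inter_mul_J_of_ne (by omega) (by omega) (by omega) (by omega),
        mul_smul, h0, smul_comm]
    · rw [← mul_smul, ← hS.inter_mul_J_succ hi, mul_smul, h2, smul_comm]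
  rw [inter_smul h0 h1] at h3
  rw [inter_smul h1 h2] at h4
  have hce1 : c - e ≠ 0 := sub_ne_zero.2 hce
  have hce2 : e - c ≠ 0 := sub_ne_zero.2 hce.symm
  set h := q - q⁻¹
  have h5 : s i • x = (-(h * e) / (c - e)) • x := by
    rw [div_eq_inv_mul, mul_smul, neg_smul, ← eq_neg_of_add_eq_zero_left h3,
      inv_smul_smul₀ hce1]
  have h6 : s (i + 1) • x = (-(h * c) / (e - c)) • x := by
    rw [div_eq_inv_mul, mul_smul, neg_smul, ← eq_neg_of_add_eq_zero_left h4,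
      inv_smul_smul₀ hce2]
  have hb : ∀ α β : K, s i • x = α • x → s (i + 1) • x = β • x →
      (α * β * α) • x = (β * α * β) • x := by
    intro α β hα hβ
    have h7 : (s i * s (i + 1) * s i) • x = (s (i + 1) * s i * s (i + 1)) • x := by
      rw [hS.braid i hi]
    simp only [mul_smul] at h7
    rw [hα, hβ, smul_comm _ α, hβ, smul_comm (s i) α, smul_comm (s i) β, hα,
      smul_comm (s (i + 1)) β, smul_comm (s (i + 1)) α, hβ] at h7
    rw [mul_smul, mul_smul, mul_smul, mul_smul, ← h7]
  have h8 := hb _ _ h5 h6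
  rw [← sub_eq_zero, ← sub_smul, smul_eq_zero] at h8
  refine h8.resolve_left fun h8 => ?_
  have h9 : h ^ 3 * e * c * (e + c) = 0 := by
    have h10 : -(h * e) / (c - e) * (-(h * c) / (e - c)) * (-(h * e) / (c - e)) -
        -(h * c) / (e - c) * (-(h * e) / (c - e)) * (-(h * c) / (e - c)) =
        h ^ 3 * e * c * (e + c) / (c - e) ^ 3 := by
      rw [← neg_sub c e]
      field_simp
      ring
    rw [h10, div_eq_zero_iff] at h8
    exact h8.resolve_right (pow_ne_zero 3 hce1)
  have := mul_ne_zero (mul_ne_zero (mul_ne_zero (pow_ne_zero 3 hh) he0) hc0) hce'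
  exact this h9

end IsJMSystem

end Spectrum

/-! ### Strings of eigenvalues are content strings -/

section Induction

variable {K A V : Type*} [Field K] [Ring A] [Algebra K A] [AddCommGroup V] [Module K V]
  [Module A V] [IsScalarTower K A V]
  {m n : ℕ} {q : K} {v : Fin m → K} {s J : ℕ → A}

theorem SemisimpleOver.inv_mul_eq (hP : SemisimpleOver q v n) {c d : K} :
    c = (q ^ 2)⁻¹ * d ↔ d = q ^ 2 * c :=
  ⟨fun h => by rw [h, mul_inv_cancel_left₀ (pow_ne_zero 2 hP.q_ne_zero)],
    fun h => by rw [h, inv_mul_cancel_left₀ (pow_ne_zero 2 hP.q_ne_zero)]⟩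

namespace IsJMSystem

/-- Two equal entries of a string of eigenvalues enclose entries of both neighbouring values. -/
theorem no_return (hS : IsJMSystem q v n s J) (hP : SemisimpleOver q v n) {k : ℕ} (hk : k < n)
    (hD : JDiagonalizable K J n k V)
    (hC : ∀ (a : ℕ → K) (x : V), x ≠ 0 → IsEig J k a x → IsContentString q v k a)
    {t : K} (ht : t = q ^ 2 ∨ t = (q ^ 2)⁻¹) (d p r : ℕ) (hr : r ≤ k) (hpr : r = p + 1 + d)
    (a : ℕ → K) (x : V) (hx0 : x ≠ 0) (hx : IsEig J (k + 1) a x) (hap : a p = a r)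
    (h1 : ∀ u, p < u → u < r → a u ≠ a r ∧ a u ≠ t * a r)
    (h2 : ∀ u u', p < u → u < r → p < u' → u' < r → a r = t * a u → a r = t * a u' → u = u') :
    False := by
  have hq := hP.q_ne_zero
  have hN : ∀ i < k, ∀ z : V, SemisimpleAt (K := K) (J i) z :=
    fun i hi z => hS.semisimpleAt hk.le hD hi z
  induction d generalizing p r a x with
  | zero =>
    subst hpr
    refine hx0 (hS.eq_zero_of_eq_succ hP (i := p) (by omega) (hN p (by omega))
      ((hC a x hx0 (hx.mono (by omega))).ne_zero hq hP.v_ne_zero (i := p) (by omega))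
      (hx p (by omega)) ?_)
    rw [hap]
    exact hx (p + 1) (by omega)
  | succ d ih =>
    have hsep : ∀ u, p < u → u < r → Separated q (a u) (a r) ∨ a r = t * a u := by
      intro u hu hu'
      by_cases h3 : a r = t * a u
      · exact Or.inr h3
      · obtain ⟨h4, h5⟩ := h1 u hu hu'
        refine Or.inl ⟨h4, ?_⟩
        rcases ht with rfl | rfl
        · exact ⟨h5, h3⟩
        · exact ⟨fun h => h3 (hP.inv_mul_eq.2 h), fun h => h5 (hP.inv_mul_eq.2 h)⟩
    obtain ⟨w, rfl⟩ : ∃ w, r = w + 1 := ⟨p + 1 + d, by omega⟩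
    -- The equal entries are moved towards each other by intertwiners. When neither can move, the
    -- entries next to them both have the one neighbouring value that is allowed once, so they are
    -- the same entry and the pattern is `c, e, c`.
    rcases hsep w (by omega) (by omega) with h3 | h3
    · have hw : ∀ u, p < u → u < w → a (Equiv.swap w (w + 1) u) = a u := fun u hu hu' => by
        rw [Equiv.swap_apply_of_ne_of_ne (by omega) (by omega)]
      refine ih p w (by omega) (by omega) (fun j => a (Equiv.swap w (w + 1) j))
        (inter q s J w • x) ?_ (hS.isEig_inter_smul (by omega) (by omega) hx) ?_ ?_ ?_
      · exact hS.inter_smul_ne_zero hq (by omega) hx0 (hx w (by omega)) (hx (w + 1) (by omega))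
          h3.2.1 h3.2.2
      · rw [Equiv.swap_apply_left, Equiv.swap_apply_of_ne_of_ne (by omega) (by omega), hap]
      · intro u hu hu'
        rw [hw u hu hu', Equiv.swap_apply_left]
        exact h1 u hu (by omega)
      · intro u u' hu hu' hv hv'
        rw [hw u hu hu', hw u' hv hv', Equiv.swap_apply_left]
        exact h2 u u' hu (by omega) hv (by omega)
    · rcases hsep (p + 1) (by omega) (by omega) with h4 | h4
      · have hw : ∀ u, p + 1 < u → a (Equiv.swap p (p + 1) u) = a u := fun u hu => by
          rw [Equiv.swap_apply_of_ne_of_ne (by omega) (by omega)]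
        refine ih (p + 1) (w + 1) (by omega) (by omega) (fun j => a (Equiv.swap p (p + 1) j))
          (inter q s J p • x) ?_ (hS.isEig_inter_smul (by omega) (by omega) hx) ?_ ?_ ?_
        · rw [← hap] at h4
          exact hS.inter_smul_ne_zero hq (by omega) hx0 (hx p (by omega))
            (hx (p + 1) (by omega)) h4.2.2 h4.2.1
        · rw [Equiv.swap_apply_right, hw _ (by omega), hap]
        · intro u hu hu'
          rw [hw u hu, hw _ (by omega)]
          exact h1 u (by omega) hu'
        · intro u u' hu hu' hv hv'
          rw [hw u hu, hw u' hv, hw _ (by omega)]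
          exact h2 u u' (by omega) hu' (by omega) hv'
      · have h5 := h2 w (p + 1) (by omega) (by omega) (by omega) (by omega) h3 h4
        subst h5
        have hcs := hC a x hx0 (hx.mono (by omega))
        have hc0 := hcs.ne_zero hq hP.v_ne_zero (i := p) (by omega)
        have he0 := hcs.ne_zero hq hP.v_ne_zero (i := p + 1) (by omega)
        refine hx0 (hS.eq_zero_of_return hP (i := p) (by omega) (hN p (by omega))
          (hN (p + 1) (by omega)) hc0 he0 ?_ ?_ (hx p (by omega))
          (hx (p + 1) (by omega)) ?_)
        · rw [hap]
          exact (h1 (p + 1) (by omega) (by omega)).1.symm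
        -- The sum of the two values is `(1 + t) * e`, and `t = -1` would give `q ^ 4 = 1`.
        · rw [hap, h4, ← one_add_mul]
          refine mul_ne_zero (fun h6 => ?_) he0
          have h7 : t = -1 := by linear_combination h6
          refine hP.pow_ne_one (by omega) 2 (by omega) (by omega) ?_
          rcases ht with h8 | h8
          · rw [← h8, h7]; norm_num
          · rw [← inv_inv (q ^ 2), ← h8, h7]; norm_num
        · rw [hap]
          exact hx (p + 2) (by omega)

/-- Intertwiners carry a separated entry to the front without killing the vector; there it is an
eigenvalue of `J 0`, hence a root of the cyclotomic polynomial. -/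
theorem exists_eq_of_separated (hS : IsJMSystem q v n s J) (hP : SemisimpleOver q v n) {k : ℕ}
    (hk : k ≤ n) {r : ℕ} (hr : r < k) (a : ℕ → K) (x : V) (hx0 : x ≠ 0) (hx : IsEig J k a x)
    (h : ∀ p < r, Separated q (a p) (a r)) : ∃ j, a r = v j := by
  induction r generalizing a x with
  | zero =>
    have h1 := aeval_smul_of_smul_eq (hx 0 hr)
      (∏ j : Fin m, (Polynomial.X - Polynomial.C (v j)))
    rw [hS.cyclotomic, zero_smul, eq_comm, smul_eq_zero, Polynomial.eval_prod,
      Finset.prod_eq_zero_iff] at h1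
    obtain ⟨j, -, hj⟩ := h1.resolve_right hx0
    exact ⟨j, by simpa [sub_eq_zero] using hj⟩
  | succ r ih =>
    have h1 := h r (by omega)
    have h2 := ih (by omega) (fun j => a (Equiv.swap r (r + 1) j)) (inter q s J r • x)
      (hS.inter_smul_ne_zero hP.q_ne_zero (by omega) hx0 (hx r (by omega)) (hx (r + 1) hr)
        h1.2.1 h1.2.2) (hS.isEig_inter_smul hk hr hx) ?_
    · rwa [Equiv.swap_apply_left] at h2
    · intro p hp
      rw [Equiv.swap_apply_left, Equiv.swap_apply_of_ne_of_ne (by omega) (by omega)]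
      exact h p (by omega)

/-- The enclosure condition comes from `no_return`, applied to the last earlier occurrence `p` of
the new entry with `t` equal to `q ^ 2` or its inverse. If the new entry were neither some `v j` nor
a neighbour of an earlier entry, enclosure would make it separated from all of them, against
`exists_eq_of_separated`. -/
theorem isContentString_succ (hS : IsJMSystem q v n s J) (hP : SemisimpleOver q v n) {k : ℕ}
    (hk : k < n) (hD : JDiagonalizable K J n k V)
    (hC : ∀ (a : ℕ → K) (x : V), x ≠ 0 → IsEig J k a x → IsContentString q v k a)
    (a : ℕ → K) (x : V) (hx0 : x ≠ 0) (hx : IsEig J (k + 1) a x) :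
    IsContentString q v (k + 1) a := by
  have hq := hP.q_ne_zero
  have hcs := hC a x hx0 (hx.mono (Nat.le_succ k))
  have hret : ∀ i < k, a i = a k →
      (∃ p, i < p ∧ p < k ∧ a p = q ^ 2 * a k) ∧ ∃ p, i < p ∧ p < k ∧ a k = q ^ 2 * a p := by
    have hlast : ∀ i < k, a i = a k → ∃ p, i ≤ p ∧ p < k ∧ a p = a k ∧
        ∀ u, p < u → u < k → a u ≠ a k := by
      intro i hi hik
      classical
      let S := (Finset.Ico i k).filter fun p => a p = a k
      have hne : S.Nonempty := ⟨i, by simp [S, hi, hik]⟩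
      have hmem := S.max'_mem hne
      simp only [S, Finset.mem_filter, Finset.mem_Ico] at hmem
      refine ⟨_, hmem.1.1, hmem.1.2, hmem.2, fun u hu hu' hau => ?_⟩
      have := S.le_max' u (by simp [S, hau, hu']; exact hmem.1.1.trans hu.le)
      exact absurd hu (not_lt.2 this)
    intro i hi hik
    obtain ⟨p, hip, hpk, hap, hp⟩ := hlast i hi hik
    constructor
    · by_contra! hno
      refine hS.no_return hP hk hD hC (Or.inl rfl) (k - p - 1) p k le_rfl (by omega) a x hx0 hx
        hap (fun u hu hu' => ⟨hp u hu hu', hno u (by omega) hu'⟩) ?_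
      -- Two such entries would enclose a further occurrence of `a k` after `p`.
      have key : ∀ u u', p < u → u < u' → u' < k → a k = q ^ 2 * a u → a k = q ^ 2 * a u' →
          False := by
        intro u u' h1 h2 h3 h4 h5
        have h6 : a u = a u' := mul_left_cancel₀ (pow_ne_zero 2 hq) (h4.symm.trans h5)
        obtain ⟨⟨w, hw1, hw2, hw3⟩, -⟩ := (hcs u' h3).2 u h2 h6
        exact hp w (by omega) (by omega) (hw3.trans h5.symm)
      intro u u' h1 h2 h3 h4 h5 h6
      rcases lt_trichotomy u u' with h7 | h7 | h7
      · exact (key u u' h1 h7 h4 h5 h6).elim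
      · exact h7
      · exact (key u' u h3 h7 h2 h6 h5).elim
    · by_contra! hno
      refine hS.no_return hP hk hD hC (Or.inr rfl) (k - p - 1) p k le_rfl (by omega) a x hx0 hx
        hap (fun u hu hu' => ⟨hp u hu hu', fun h => hno u (by omega) hu' (hP.inv_mul_eq.1 h)⟩) ?_
      have key : ∀ u u', p < u → u < u' → u' < k → a u = q ^ 2 * a k → a u' = q ^ 2 * a k →
          False := by
        intro u u' h1 h2 h3 h4 h5
        obtain ⟨-, w, hw1, hw2, hw3⟩ := (hcs u' h3).2 u h2 (h4.trans h5.symm)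
        exact hp w (by omega) (by omega)
          (mul_left_cancel₀ (pow_ne_zero 2 hq) (hw3.symm.trans h5))
      intro u u' h1 h2 h3 h4 h5 h6
      rw [hP.inv_mul_eq] at h5 h6
      rcases lt_trichotomy u u' with h7 | h7 | h7
      · exact (key u u' h1 h7 h4 h5 h6).elim
      · exact h7
      · exact (key u' u h3 h7 h2 h6 h5).elim
  intro i hi
  rcases Nat.lt_or_ge i k with h1 | h1
  · exact hcs i h1
  obtain rfl : i = k := by omega
  refine ⟨?_, hret⟩
  by_contra! hno
  obtain ⟨j, hj⟩ := hS.exists_eq_of_separated hP (by omega) hi a x hx0 hx (fun p hp =>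
    ⟨fun h => by
      obtain ⟨⟨w, -, hw, hw'⟩, -⟩ := hret p hp h
      exact (hno.2 w hw).1 hw', (hno.2 p hp).1, (hno.2 p hp).2⟩)
  exact hno.1 j hj

end IsJMSystem

end Induction

/-! ### Simultaneous diagonalization -/

section Diagonalization

variable {K A V : Type*} [Field K] [Ring A] [Algebra K A] [AddCommGroup V] [Module K V]
  [Module A V] [IsScalarTower K A V]
  {m n : ℕ} {q : K} {v : Fin m → K} {s J : ℕ → A}

theorem SemisimpleOver.not_both (hP : SemisimpleOver q v n) {k : ℕ} (hk : k + 2 ≤ n)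
    {a b : ℕ → K} (ha : IsContentString q v (k + 1) a) (hb : IsContentString q v (k + 1) b)
    (hab : ∀ i < k, a i = b i) (h : a k = q ^ 2 * b k ∨ b k = q ^ 2 * a k) : False := by
  have h1 := (ha k (Nat.lt_succ_self k)).congr hab
  have h2 := hb k (Nat.lt_succ_self k)
  rcases h with h | h
  · rw [h] at h1
    exact not_appendable_both hP hk (hb.mono (Nat.le_succ k)) h2 h1
  · rw [h] at h2
    exact not_appendable_both hP hk (hb.mono (Nat.le_succ k)) h1 h2

namespace IsJMSystem

open Polynomial in
theorem inter_mul_aeval (hS : IsJMSystem q v n s J) {i : ℕ} (hi : i + 1 < n) (p : K[X]) :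
    inter q s J i * aeval (J i) p = aeval (J (i + 1)) p * inter q s J i := by
  have hk : ∀ k, inter q s J i * J i ^ k = J (i + 1) ^ k * inter q s J i :=
    fun k => (SemiconjBy.pow_right (hS.inter_mul_J hi) k)
  induction p using Polynomial.induction_on' with
  | add p r hp hr => rw [map_add, map_add, mul_add, add_mul, hp, hr]
  | monomial k r =>
    rw [aeval_monomial, aeval_monomial, ← mul_assoc, ← Algebra.commutes, mul_assoc, hk, mul_assoc]

-- If `P(J k)` kills `U z`, then `0 = U P(J k) U z = P(J (k + 1)) U² z`, and on `z` the square `U²`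
-- is quadratic in `J (k + 1)`. An annihilating polynomial thus passes from `J k` to `J (k + 1)`.
open Polynomial in
theorem exists_list_succ (hS : IsJMSystem q v n s J) (hP : SemisimpleOver q v n) {k : ℕ}
    (hk : k + 1 < n) (hD : JDiagonalizable K J n (k + 1) V) {b : K} {z : V}
    (hz : J k • z = b • z) :
    ∃ l : List K, aeval (J (k + 1)) (l.map fun c => X - C c).prod • z = 0 := by
  obtain ⟨l, hl⟩ := exists_list_of_mem_span (T := J k) (K := K)
    (fun z hz => by
      obtain ⟨-, a, ha⟩ := hz
      exact ⟨a k, ha k (Nat.lt_succ_self k)⟩) (hD (inter q s J k • z))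
  refine ⟨l ++ [q ^ 2 * b, (q ^ 2)⁻¹ * b], ?_⟩
  have h1 := congrArg (fun y => inter q s J k • y) hl
  simp only [smul_zero] at h1
  rw [← mul_smul, hS.inter_mul_aeval hk, mul_smul, hS.inter_inter_smul hP.q_ne_zero hk hz,
    smul_neg, neg_eq_zero] at h1
  rw [List.map_append, List.prod_append, map_mul, mul_smul]
  simpa [mul_smul] using h1

/-- Suppose `z = (J (k + 1) - d) w` is nonzero and killed by `J (k + 1) - d`. Semisimplicity of `J
k` gives `U z = 0`, so `d` is a neighbour of `a k`. A nonzero `U w` would have the string of `w`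
with `a k` replaced by `d`, against `not_both`. So `U w = 0`, and `w` is killed by a quadratic
polynomial in `J (k + 1)` with two distinct roots, which leaves no room for a Jordan block. -/
theorem semisimpleAt_succ (hS : IsJMSystem q v n s J) (hP : SemisimpleOver q v n) {k : ℕ}
    (hk : k + 1 < n) (hD : JDiagonalizable K J n (k + 1) V)
    (hC : ∀ (a : ℕ → K) (x : V), x ≠ 0 → IsEig J (k + 1) a x → IsContentString q v (k + 1) a)
    {a : ℕ → K} {w : V} (hw : IsEig J (k + 1) a w) : SemisimpleAt (K := K) (J (k + 1)) w := by
  intro d hd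
  have hq := hP.q_ne_zero
  by_contra hne
  set z := J (k + 1) • w - d • w with hzdef
  have hz0 : z ≠ 0 := sub_ne_zero.2 hne
  have hw0 : w ≠ 0 := by
    rintro rfl
    exact hz0 (by simp [hzdef])
  have hsub : ∀ y : V, (J (k + 1) - algebraMap K A d) • y = J (k + 1) • y - d • y := fun y => by
    rw [sub_smul, algebraMap_smul]
  have hz : IsEig J (k + 1) a z := by
    rw [hzdef, ← hsub]
    exact hS.isEig_smul hk.le hw
      (Subalgebra.sub_mem _ (J_mem_jmAlg hk) (Subalgebra.algebraMap_mem _ d))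
  have hb := hw k (Nat.lt_succ_self k)
  have hbz := hz k (Nat.lt_succ_self k)
  have hX : ∀ y : V, J k • inter q s J k • y = inter q s J k • J (k + 1) • y := fun y => by
    rw [← mul_smul, ← hS.inter_mul_J_succ hk, mul_smul]
  have h1 : J k • inter q s J k • w - d • inter q s J k • w = inter q s J k • z := by
    rw [hX, hzdef, smul_sub, smul_comm d]
  have h2 : J k • inter q s J k • w = d • inter q s J k • w := by
    refine hS.semisimpleAt hk.le hD (Nat.lt_succ_self k) _ d ?_
    rw [h1, hX, hd, smul_comm]
  have h3 : inter q s J k • z = 0 := by rw [← h1, h2, sub_self]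
  have h4 : a k = q ^ 2 * d ∨ d = q ^ 2 * a k := by
    by_contra! h4
    exact hS.inter_smul_ne_zero hq hk hz0 hbz hd h4.1 h4.2 h3
  have hca := hC a w hw0 hw
  have h5 : inter q s J k • w = 0 := by
    by_contra h5
    have h6 : IsEig J (k + 1) (Function.update a k d) (inter q s J k • w) := by
      refine IsEig.succ (fun j hj => ?_) h2
      rw [← mul_smul, ← hS.inter_mul_J_of_ne hk (by omega) (by omega) (by omega), mul_smul,
        hw j (by omega), smul_comm]
    refine hP.not_both (k := k) (by omega) hca (hC _ _ h5 h6) (fun i hi => ?_) ?_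
    · rw [Function.update_of_ne hi.ne]
    · rwa [Function.update_self]
  have h6 := hS.inter_inter_smul hq hk hb
  have h7 : ∀ e e' : K, (J (k + 1) - algebraMap K A e) • (J (k + 1) - algebraMap K A e') • w = 0 →
      (J (k + 1) - algebraMap K A e') • (J (k + 1) - algebraMap K A e) • w = 0 := by
    intro e e' h
    rw [← h]
    simp only [sub_smul, smul_sub, algebraMap_smul, smul_comm (J (k + 1)) (_ : K) w, smul_comm e e']
    abel
  rw [h5, smul_zero, eq_comm, neg_eq_zero] at h6
  have h8 : ∀ e : K, (J (k + 1) - algebraMap K A e) • (J (k + 1) - algebraMap K A d) • w = 0 →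
      d = e := by
    intro e h
    rw [hsub, ← hzdef, sub_smul, hd, algebraMap_smul, ← sub_smul, smul_eq_zero, sub_eq_zero] at h
    exact h.resolve_right hz0
  have ha0 : a k ≠ 0 := hca.ne_zero hq hP.v_ne_zero (Nat.lt_succ_self k)
  have h9 : q ^ 2 * a k ≠ (q ^ 2)⁻¹ * a k := by
    intro h
    rw [hP.inv_mul_eq, ← mul_assoc, ← sq] at h
    exact hP.pow_ne_one (by omega) 2 (by omega) (by omega)
      (mul_right_cancel₀ ha0 (by rw [← h, one_mul]))
  -- One root of the quadratic relation `h6` is `d`; by `h8` the other root equals `d` as well,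
  -- against `h9`.
  rcases h4 with h4 | h4
  · rw [← hP.inv_mul_eq] at h4
    rw [← h4] at h6
    exact h9 ((h8 _ h6).symm.trans h4)
  · rw [← h4] at h6
    exact h9 (h4.symm.trans (h8 _ (h7 _ _ h6)))

theorem jDiagonalizable_succ (hS : IsJMSystem q v n s J) (hP : SemisimpleOver q v n) {k : ℕ}
    (hk : k < n) (hD : JDiagonalizable K J n k V)
    (hC : ∀ (a : ℕ → K) (x : V), x ≠ 0 → IsEig J k a x → IsContentString q v k a) :
    JDiagonalizable K J n (k + 1) V := by
  intro y
  refine Submodule.span_le.2 ?_ (hD y)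
  rintro z ⟨⟨r, hr, rfl⟩, a, ha⟩
  have hl : ∃ l : List K, Polynomial.aeval (J k)
      (l.map fun c => Polynomial.X - Polynomial.C c).prod • (r • y) = 0 := by
    rcases k with - | k
    · refine ⟨List.ofFn v, ?_⟩
      rw [List.map_ofFn, List.prod_ofFn]
      simpa using congrArg (· • (r • y)) hS.cyclotomic
    · exact hS.exists_list_succ hP hk hD (ha k (Nat.lt_succ_self k))
  obtain ⟨l, hl⟩ := hl
  refine Submodule.span_mono ?_ (mem_span_eigenvectors (jmAlg K J n) (J_mem_jmAlg hk) l (r • y)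
    (fun r' hr' => ?_) hl)
  · rintro z ⟨⟨r', hr', rfl⟩, e, he⟩
    exact ⟨⟨r' * r, Subalgebra.mul_mem _ hr' hr, (mul_smul _ _ _).symm⟩, _,
      (hS.isEig_smul hk.le ha hr').succ he⟩
  · rcases k with - | k
    · exact semisimpleAt_of_separable v
        (fun i j h => by_contra fun hij => hP.v_ne i j hij h) hS.cyclotomic _
    · exact hS.semisimpleAt_succ hP hk hD hC (hS.isEig_smul hk.le ha hr')

/-- The two claims need each other: semisimplicity of the earlier elements excludes bad strings, and
the restrictions on strings exclude Jordan blocks of the next element. -/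
theorem jDiagonalizable_and_isContentString (hS : IsJMSystem q v n s J)
    (hP : SemisimpleOver q v n) {k : ℕ} (hk : k ≤ n) :
    JDiagonalizable K J n k V ∧
      ∀ (a : ℕ → K) (x : V), x ≠ 0 → IsEig J k a x → IsContentString q v k a := by
  induction k with
  | zero =>
    refine ⟨fun y => Submodule.subset_span ⟨⟨1, Subalgebra.one_mem _, (one_smul _ _).symm⟩, 0,
      fun i hi => absurd hi (Nat.not_lt_zero i)⟩, fun a x _ _ i hi => absurd hi (Nat.not_lt_zero i)⟩
  | succ k ih =>
    obtain ⟨hD, hC⟩ := ih (by omega)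
    exact ⟨hS.jDiagonalizable_succ hP (by omega) hD hC,
      hS.isContentString_succ hP (by omega : k < n) hD hC⟩

/-- If the eigenvalues `c`, `d` of consecutive Jucys–Murphy elements are not separated, then the
intertwiner kills the eigenvector. -/
theorem inter_smul_eq_zero (hS : IsJMSystem q v n s J) (hP : SemisimpleOver q v n) {i : ℕ}
    (hi : i + 1 < n) {a : ℕ → K} {x : V} (hx : IsEig J n a x)
    (h : ¬ Separated q (a i) (a (i + 1))) : inter q s J i • x = 0 ∧ (x ≠ 0 → a i ≠ a (i + 1)) := by
  have hC := (hS.jDiagonalizable_and_isContentString (V := V) hP (le_refl n)).2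
  have hne : x ≠ 0 → a i ≠ a (i + 1) := by
    intro hx0 h1
    obtain ⟨⟨w, hw1, hw2, -⟩, -⟩ := (hC a x hx0 hx (i + 1) hi).2 i (Nat.lt_succ_self i) h1
    omega
  refine ⟨by_contra fun h0 => ?_, hne⟩
  have hx0 : x ≠ 0 := by
    rintro rfl
    exact h0 (smul_zero _)
  have hC1 := (hC a x hx0 hx).mono (by omega : i + 1 ≤ n)
  have hC2 := (hC _ _ h0 (hS.isEig_inter_smul le_rfl hi hx)).mono (by omega : i + 1 ≤ n)
  refine hP.not_both (by omega) hC1 hC2 (fun j hj => ?_) ?_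
  · rw [Equiv.swap_apply_of_ne_of_ne (by omega) (by omega)]
  · rw [Equiv.swap_apply_left]
    by_contra! h1
    exact h ⟨hne hx0, h1⟩

end IsJMSystem

end Diagonalization

/-! ### Permutations whose inversions carry separated values -/

section Permutations

open Equiv

theorem swap_succ_lt_swap_succ {i j l : ℕ} (h : j < l) (h' : ¬ (j = i ∧ l = i + 1)) :
    swap i (i + 1) j < swap i (i + 1) l := by
  simp only [swap_apply_def]
  split_ifs <;> omega

theorem swap_succ_braid (i : ℕ) :
    swap i (i + 1) * swap (i + 1) (i + 2) * swap i (i + 1) =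
      swap (i + 1) (i + 2) * swap i (i + 1) * swap (i + 1) (i + 2) := by
  ext j
  simp only [Perm.mul_apply, swap_apply_def]
  split_ifs <;> omega

theorem swap_succ_comm {i j : ℕ} (h : i + 1 < j) :
    swap i (i + 1) * swap j (j + 1) = swap j (j + 1) * swap i (i + 1) := by
  ext l
  simp only [Perm.mul_apply, swap_apply_def]
  split_ifs <;> omega

/-- A weight on permutations that decreases when a descent is removed. -/
def permWeight (n : ℕ) (w : Perm ℕ) : ℕ := ∑ j ∈ Finset.range n, (n - j) * w j

theorem permWeight_mul_swap_lt {n i : ℕ} (hi : i + 1 < n) {w : Perm ℕ} (h : w (i + 1) < w i) :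
    permWeight n (w * swap i (i + 1)) < permWeight n w := by
  have h1 : i ∈ Finset.range n := by simp; omega
  have h2 : i + 1 ∈ (Finset.range n).erase i := by simp; omega
  unfold permWeight
  rw [← Finset.add_sum_erase _ _ h1, ← Finset.add_sum_erase _ _ h2,
    ← Finset.add_sum_erase _ _ h1, ← Finset.add_sum_erase _ _ h2]
  have h3 : ∑ j ∈ ((Finset.range n).erase i).erase (i + 1), (n - j) * (w * swap i (i + 1)) j =
      ∑ j ∈ ((Finset.range n).erase i).erase (i + 1), (n - j) * w j := by
    refine Finset.sum_congr rfl fun j hj => ?_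
    simp only [Finset.mem_erase] at hj
    rw [Perm.mul_apply, swap_apply_of_ne_of_ne hj.2.1 hj.1]
  rw [h3, Perm.mul_apply, Perm.mul_apply, swap_apply_left, swap_apply_right]
  obtain ⟨N, rfl⟩ : ∃ N, n = N + (i + 1) := ⟨n - (i + 1), by omega⟩
  have h4 : N + (i + 1) - i = N + 1 := by omega
  rw [h4, Nat.add_sub_cancel]
  linarith [add_mul N 1 (w i), add_mul N 1 (w (i + 1))]

theorem exists_descent {n : ℕ} {w : Perm ℕ} (hw : ∀ i, n ≤ i → w i = i) (h : w ≠ 1) :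
    ∃ i, i + 1 < n ∧ w (i + 1) < w i := by
  by_contra! hno
  have hmono : StrictMono w := by
    refine strictMono_nat_of_lt_succ fun i => ?_
    rcases Nat.lt_or_ge (i + 1) n with h1 | h1
    · exact lt_of_le_of_ne (hno i h1) fun h2 => by
        have := w.injective h2
        omega
    · rw [hw _ h1]
      by_contra! h2
      have h3 := hw (w i) (by omega)
      have h4 := w.injective h3
      omega
  have hmono' : StrictMono (w⁻¹ : Perm ℕ) := fun i j hij => by
    rw [← hmono.lt_iff_lt]
    simpa using hij
  refine h (Equiv.ext fun i => le_antisymm ?_ (hmono.le_apply))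
  have := hmono'.le_apply (x := w i)
  simpa using this

variable {K : Type*} [Field K]

/-- All pairs of labels that are out of order in `w` carry separated values. -/
structure SeparatedPerm (q : K) (n : ℕ) (a : ℕ → K) (w : Perm ℕ) : Prop where
  fix : ∀ i, n ≤ i → w i = i
  sep : ∀ i j, i < j → j < n → w j < w i → Separated q (a (w i)) (a (w j))

variable {q : K} {n : ℕ} {a : ℕ → K} {w : Perm ℕ}

theorem separatedPerm_one : SeparatedPerm q n a 1 :=
  ⟨fun _ _ => rfl, fun i j h _ h' => absurd h (by simpa using h'.le)⟩

theorem SeparatedPerm.mul_swap (hw : SeparatedPerm q n a w) {i : ℕ} (hi : i + 1 < n)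
    (h : w i < w (i + 1) → Separated q (a (w i)) (a (w (i + 1)))) :
    SeparatedPerm q n a (w * swap i (i + 1)) := by
  refine ⟨fun j hj => ?_, fun j l hjl hl h1 => ?_⟩
  · rw [Perm.mul_apply, swap_apply_of_ne_of_ne (by omega) (by omega), hw.fix j hj]
  · rw [Perm.mul_apply, Perm.mul_apply] at h1 ⊢
    by_cases h2 : j = i ∧ l = i + 1
    · obtain ⟨rfl, rfl⟩ := h2
      rw [swap_apply_left, swap_apply_right] at h1 ⊢
      exact (h h1).symm
    · refine hw.sep _ _ (swap_succ_lt_swap_succ hjl h2) ?_ h1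
      rw [swap_apply_def]
      split_ifs <;> omega

/-- At the first position `i` that is moved, the label `w i` exceeds `i`, and the label `i` stands
further right. This inversion would have to separate `a (w i)` from `a i`, yet these are equal. -/
theorem SeparatedPerm.eq_one (hw : SeparatedPerm q n a w) (h : ∀ i < n, a (w i) = a i) :
    w = 1 := by
  refine Equiv.ext fun i => ?_
  induction i using Nat.strong_induction_on with
  | _ i ih =>
    rw [Perm.one_apply]
    rcases Nat.lt_or_ge i n with hi | hi
    · obtain ⟨j, hj⟩ := w.surjective i
      rcases lt_trichotomy j i with h1 | h1 | h1
      · have := ih j h1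
        rw [Perm.one_apply, hj] at this
        omega
      · rwa [h1] at hj
      · have hjn : j < n := by
          by_contra! hjn
          have := hw.fix j hjn
          omega
        have h2 : i < w i := by
          rcases lt_trichotomy (w i) i with h3 | h3 | h3
          · have := ih _ h3
            rw [Perm.one_apply] at this
            have := w.injective this
            omega
          · have := w.injective (hj.trans h3.symm)
            omega
          · exact h3
        refine absurd ?_ (hw.sep i j h1 hjn (by rwa [hj])).1
        rw [h i hi, h j hjn, ← h j hjn, hj]
    · exact hw.fix i hi

end Permutations

/-! ### Baxterized generators and independence of the reduced path -/

section Orbit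

open Equiv

variable {K A V : Type*} [Field K] [Ring A] [Algebra K A] [AddCommGroup V] [Module A V]
  {m n : ℕ} {q : K} {v : Fin m → K} {s J : ℕ → A}

/-- The coefficient of the Baxterized generator `σ + (q - q⁻¹) d / (c - d)`. -/
def baxterCoeff (q c d : K) : K := (q - q⁻¹) * d / (c - d)

/-- After expansion the two sides differ only in the coefficients of `x` and `y`, and the hypothesis
on `α`, `β`, `γ` equates these. `baxterCoeff_relation` supplies it for three distinct eigenvalues.
-/
theorem yang_baxter {x y : A} {h α β γ : K} (hx : x * x = h • x + 1) (hy : y * y = h • y + 1)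
    (hxy : x * y * x = y * x * y) (hab : β * (h + α + γ) = α * γ) :
    (x + algebraMap K A α) * (y + algebraMap K A β) * (x + algebraMap K A γ) =
      (y + algebraMap K A γ) * (x + algebraMap K A β) * (y + algebraMap K A α) := by
  have h1 : (x + algebraMap K A α) * (y + algebraMap K A β) * (x + algebraMap K A γ) =
      x * y * x + α • (y * x) + γ • (x * y) + β • (x * x) + (α * β + β * γ) • x
        + (α * γ) • y + (α * β * γ) • (1 : A) := by
    simp only [Algebra.algebraMap_eq_smul_one, add_mul, mul_add, smul_mul_assoc, mul_smul_comm,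
      one_mul, mul_one]
    module
  have h2 : (y + algebraMap K A γ) * (x + algebraMap K A β) * (y + algebraMap K A α) =
      y * x * y + γ • (x * y) + α • (y * x) + β • (y * y) + (α * β + β * γ) • y
        + (α * γ) • x + (α * β * γ) • (1 : A) := by
    simp only [Algebra.algebraMap_eq_smul_one, add_mul, mul_add, smul_mul_assoc, mul_smul_comm,
      one_mul, mul_one]
    module
  rw [h1, h2, hx, hy, hxy, ← hab]
  module

theorem baxterCoeff_relation {c d e : K} (h1 : c ≠ d) (h2 : d ≠ e) (h3 : c ≠ e) :
    baxterCoeff q c e * (q - q⁻¹ + baxterCoeff q d e + baxterCoeff q c d) =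
      baxterCoeff q d e * baxterCoeff q c d := by
  have h4 := sub_ne_zero.2 h1
  have h5 := sub_ne_zero.2 h2
  have h6 := sub_ne_zero.2 h3
  unfold baxterCoeff
  generalize q - q⁻¹ = h
  field_simp
  ring

/-- `y` is obtained from `x` by Baxterized generators along a reduced path to `w`. -/
inductive Reaches (q : K) (s : ℕ → A) (n : ℕ) (a : ℕ → K) (x : V) : Perm ℕ → V → Prop
  | refl : Reaches q s n a x 1 x
  | step (w : Perm ℕ) (y : V) (i : ℕ) (hi : i + 1 < n) (hw : w (i + 1) < w i)
      (hsep : Separated q (a (w (i + 1))) (a (w i)))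
      (hy : Reaches q s n a x (w * swap i (i + 1)) y) :
      Reaches q s n a x w
        ((s i + algebraMap K A (baxterCoeff q (a (w (i + 1))) (a (w i)))) • y)

variable {a : ℕ → K} {x : V}

theorem Reaches.separatedPerm {w : Perm ℕ} {y : V} (h : Reaches q s n a x w y) :
    SeparatedPerm q n a w := by
  induction h with
  | refl => exact separatedPerm_one
  | step w y i hi hw hsep hy ih =>
    have h1 := ih.mul_swap hi (fun _ => by simpa using hsep)
    rwa [mul_assoc, swap_mul_self, mul_one] at h1

theorem SeparatedPerm.exists_reaches {w : Perm ℕ} (hw : SeparatedPerm q n a w) :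
    ∃ y, Reaches q s n a x w y := by
  induction hN : permWeight n w using Nat.strong_induction_on generalizing w with
  | _ N ih =>
    by_cases h1 : w = 1
    · subst h1
      exact ⟨x, Reaches.refl⟩
    · obtain ⟨i, hi, hlt⟩ := exists_descent hw.fix h1
      obtain ⟨y, hy⟩ := ih _ (hN ▸ permWeight_mul_swap_lt hi hlt)
        (hw.mul_swap hi fun h => absurd h (not_lt.2 hlt.le)) rfl
      exact ⟨_, Reaches.step w y i hi hlt (hw.sep i (i + 1) (Nat.lt_succ_self i) hi hlt).symm hy⟩

/-- The constructor with its labels given up to equality, so that different routes to one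
permutation display the same coefficients. -/
theorem Reaches.step_of_eq {w u : Perm ℕ} {y : V} {i p r : ℕ} (hi : i + 1 < n)
    (hu : w * swap i (i + 1) = u) (hp : w (i + 1) = p) (hr : w i = r) (hpr : p < r)
    (hsep : Separated q (a p) (a r)) (hy : Reaches q s n a x u y) :
    Reaches q s n a x w ((s i + algebraMap K A (baxterCoeff q (a p) (a r))) • y) := by
  subst hu hp hr
  exact Reaches.step w y i hi hpr hsep hy

/-- Uniqueness of reached vectors, for two paths that end with different descents. -/
theorem Reaches.unique_of_lt (hS : IsJMSystem q v n s J) {w : Perm ℕ} {y₁ y₂ : V} {i j : ℕ}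
    (hij : i < j) (hj : j + 1 < n) (hwi : w (i + 1) < w i) (hwj : w (j + 1) < w j)
    (hsi : Separated q (a (w (i + 1))) (a (w i))) (hsj : Separated q (a (w (j + 1))) (a (w j)))
    (h₁ : Reaches q s n a x (w * swap i (i + 1)) y₁)
    (h₂ : Reaches q s n a x (w * swap j (j + 1)) y₂)
    (u₁ : ∀ y, Reaches q s n a x (w * swap i (i + 1)) y → y₁ = y)
    (u₂ : ∀ y, Reaches q s n a x (w * swap j (j + 1)) y → y₂ = y) :
    (s i + algebraMap K A (baxterCoeff q (a (w (i + 1))) (a (w i)))) • y₁ =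
      (s j + algebraMap K A (baxterCoeff q (a (w (j + 1))) (a (w j)))) • y₂ := by
  have hswap : ∀ l p, p ≠ l → p ≠ l + 1 → (w * swap l (l + 1)) p = w p := fun l p h h' => by
    rw [Perm.mul_apply, swap_apply_of_ne_of_ne h h']
  have hl : ∀ (w : Perm ℕ) l, (w * swap l (l + 1)) l = w (l + 1) := fun w l => by
    rw [Perm.mul_apply, swap_apply_left]
  have hr : ∀ (w : Perm ℕ) l, (w * swap l (l + 1)) (l + 1) = w l := fun w l => by
    rw [Perm.mul_apply, swap_apply_right]
  rcases Nat.lt_or_ge (i + 1) j with hlt | hge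
  -- Distant descents: both paths are rerouted through a vector `z` with both descents removed, and
  -- the last two factors commute.
  · have e1 := hswap i j (by omega) (by omega)
    have e2 := hswap i (j + 1) (by omega) (by omega)
    have e3 := hswap j i (by omega) (by omega)
    have e4 := hswap j (i + 1) (by omega) (by omega)
    obtain ⟨z, hz⟩ := (h₁.separatedPerm.mul_swap hj (fun h => by
      rw [e1, e2] at h
      exact absurd h (not_lt.2 hwj.le))).exists_reaches (s := s) (x := x)
    rw [u₁ _ (Reaches.step_of_eq hj rfl e2 e1 hwj hsj hz),
      u₂ _ (Reaches.step_of_eq (by omega) (by rw [mul_assoc, ← swap_succ_comm hlt, ← mul_assoc])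
        e4 e3 hwi hsi hz), ← mul_smul, ← mul_smul]
    congr 1
    have hc := hS.s_comm i j (by omega) hj hlt
    simp only [Algebra.algebraMap_eq_smul_one, add_mul, mul_add, smul_mul_assoc, mul_smul_comm,
      one_mul, mul_one, hc]
    module
  -- Adjacent descents: the labels at `i`, `i + 1`, `i + 2` are decreasing. Both paths are rerouted
  -- through a vector `z` where they are increasing, and the two triple products agree by
  -- Yang–Baxter.
  · obtain rfl : j = i + 1 := by omega
    have e1 := hswap i (i + 2) (by omega) (by omega)
    have e2 := hr w i
    have e3 := hswap (i + 1) i (by omega) (by omega)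
    have e4 := hl w (i + 1)
    have e5 : (w * swap i (i + 1) * swap (i + 1) (i + 2)) i = w (i + 1) := by
      rw [Perm.mul_apply, swap_apply_of_ne_of_ne (by omega) (by omega), hl]
    have e6 : (w * swap i (i + 1) * swap (i + 1) (i + 2)) (i + 1) = w (i + 2) := by
      rw [hl _ (i + 1), e1]
    have e7 : (w * swap (i + 1) (i + 2) * swap i (i + 1)) (i + 1) = w i := by
      rw [hr, e3]
    have e8 : (w * swap (i + 1) (i + 2) * swap i (i + 1)) (i + 2) = w (i + 1) := by
      rw [Perm.mul_apply, swap_apply_of_ne_of_ne (by omega) (by omega), hr _ (i + 1)]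
    have hlt : w (i + 2) < w i := hwj.trans hwi
    have hs1 := h₁.separatedPerm.mul_swap hj (fun h => by
      rw [e1, e2] at h
      exact absurd h (not_lt.2 hlt.le))
    have hsep : Separated q (a (w (i + 2))) (a (w i)) := by
      have := h₁.separatedPerm.sep (i + 1) (i + 2) (by omega) hj (by rw [e1, e2]; exact hlt)
      rw [e1, e2] at this
      exact this.symm
    obtain ⟨z, hz⟩ := (hs1.mul_swap (i := i) (by omega) (fun h => by
      rw [e5, e6] at h
      exact absurd h (not_lt.2 hwj.le))).exists_reaches (s := s) (x := x)
    have hbr : w * swap (i + 1) (i + 2) * swap i (i + 1) * swap (i + 1) (i + 2) =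
        w * swap i (i + 1) * swap (i + 1) (i + 2) * swap i (i + 1) := by
      have := congrArg (w * ·) (swap_succ_braid i)
      simp only [← mul_assoc] at this
      exact this.symm
    rw [u₁ _ (Reaches.step_of_eq hj rfl e1 e2 hlt hsep
        (Reaches.step_of_eq (by omega) rfl e6 e5 hwj hsj hz)),
      u₂ _ (Reaches.step_of_eq (by omega) rfl e4 e3 hlt hsep
        (Reaches.step_of_eq hj hbr e8 e7 hwi hsi hz))]
    simp only [← mul_smul]
    rw [← mul_assoc, ← mul_assoc]
    congr 1
    exact yang_baxter (hS.quad i (by omega)) (hS.quad (i + 1) hj) (hS.braid i hj)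
      (baxterCoeff_relation hsj.1 hsi.1 hsep.1)

/-- A form of Matsumoto's theorem, by induction on the weight: two reduced paths to `w` with
different last steps are compared through `unique_of_lt`. No eigenvector property of `x` is needed.
-/
theorem Reaches.unique (hS : IsJMSystem q v n s J) {w : Perm ℕ} {y y' : V}
    (h : Reaches q s n a x w y) (h' : Reaches q s n a x w y') : y = y' := by
  induction hN : permWeight n w using Nat.strong_induction_on generalizing w y y' with
  | _ N ih =>
    have hu : ∀ i, i + 1 < n → w (i + 1) < w i → ∀ y₁ y₂,
        Reaches q s n a x (w * swap i (i + 1)) y₁ →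
        Reaches q s n a x (w * swap i (i + 1)) y₂ → y₁ = y₂ :=
      fun i hi hw y₁ y₂ h₁ h₂ => ih _ (hN ▸ permWeight_mul_swap_lt hi hw) h₁ h₂ rfl
    cases h with
    | refl =>
      cases h' with
      | refl => rfl
      | step _ y₂ j hj hwj hsj h₂ => simp at hwj
    | step _ y₁ i hi hwi hsi h₁ =>
      cases h' with
      | refl => simp at hwi
      | step _ y₂ j hj hwj hsj h₂ =>
        rcases lt_trichotomy i j with hij | rfl | hij
        · exact unique_of_lt hS hij hj hwi hwj hsi hsj h₁ h₂ (fun y => hu i hi hwi _ y h₁)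
            (fun y => hu j hj hwj _ y h₂)
        · rw [hu i hi hwi _ _ h₁ h₂]
        · exact (unique_of_lt hS hij hi hwj hwi hsj hsi h₂ h₁ (fun y => hu j hj hwj _ y h₂)
            (fun y => hu i hi hwi _ y h₁)).symm

end Orbit

/-! ### The cyclic module generated by a common eigenvector -/

section CyclicModule

open Equiv

variable {K A V : Type*} [Field K] [Ring A] [Algebra K A] [AddCommGroup V] [Module K V]
  [Module A V] [IsScalarTower K A V]
  {m n : ℕ} {q : K} {v : Fin m → K} {s J : ℕ → A}

theorem smul_mem_of_generators {S : Set A} (hS : Algebra.adjoin K S = ⊤) (M : Submodule K V)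
    (h : ∀ r ∈ S, ∀ y ∈ M, r • y ∈ M) (r : A) {y : V} (hy : y ∈ M) : r • y ∈ M := by
  have hr : r ∈ Algebra.adjoin K S := hS ▸ Algebra.mem_top
  induction hr using Algebra.adjoin_induction generalizing y with
  | mem r hr => exact h r hr y hy
  | algebraMap c => rw [algebraMap_smul]; exact M.smul_mem c hy
  | add r r' _ _ h1 h2 => rw [add_smul]; exact M.add_mem (h1 hy) (h2 hy)
  | mul r r' _ _ h1 h2 => rw [mul_smul]; exact h1 (h2 hy)

/-- A common eigenvector in the span of common eigenvectors lies in the span of those that have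
the same eigenvalues. -/
theorem IsJMSystem.mem_span_of_isEig (hS : IsJMSystem q v n s J) {E : Set V}
    (hE : ∀ y ∈ E, ∃ b : ℕ → K, IsEig J n b y) {z : V} (hz : z ∈ Submodule.span K E) {a : ℕ → K}
    (ha : IsEig J n a z) : z ∈ Submodule.span K {y ∈ E | IsEig J n a y} := by
  -- Here `p` is an interpolation product of factors `(J i - b i) / (a i - b i)`: it kills the terms
  -- with other strings and fixes every vector with string `a`.
  have key : ∀ z ∈ Submodule.span K E, ∃ u ∈ Submodule.span K {y ∈ E | IsEig J n a y},
      ∃ p ∈ jmAlg K J n, p • (z - u) = 0 ∧ ∀ y : V, IsEig J n a y → p • y = y := by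
    intro z hz
    induction hz using Submodule.span_induction with
    | mem y hy =>
      by_cases hya : IsEig J n a y
      · exact ⟨y, Submodule.subset_span ⟨hy, hya⟩, 1, Subalgebra.one_mem _, by simp, by simp⟩
      · obtain ⟨b, hb⟩ := hE y hy
        obtain ⟨i, hi, hi'⟩ : ∃ i, i < n ∧ a i ≠ b i := by
          by_contra! hab
          exact hya (hb.congr fun i hi => (hab i hi).symm)
        have hab := sub_ne_zero.2 hi'
        refine ⟨0, Submodule.zero_mem _, (a i - b i)⁻¹ • (J i - algebraMap K A (b i)),
          Subalgebra.smul_mem _ (Subalgebra.sub_mem _ (J_mem_jmAlg hi)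
            (Subalgebra.algebraMap_mem _ _)) _, ?_, fun y hy => ?_⟩
        · rw [sub_zero, smul_assoc, sub_smul, hb i hi, algebraMap_smul, sub_self, smul_zero]
        · rw [smul_assoc, sub_smul, hy i hi, algebraMap_smul, ← sub_smul, smul_smul,
            inv_mul_cancel₀ hab, one_smul]
    | zero => exact ⟨0, Submodule.zero_mem _, 1, Subalgebra.one_mem _, by simp, by simp⟩
    | add z z' _ _ h1 h2 =>
      obtain ⟨u, hu, p, hp, hpz, hpy⟩ := h1
      obtain ⟨u', hu', p', hp', hpz', hpy'⟩ := h2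
      refine ⟨u + u', Submodule.add_mem _ hu hu', p * p', Subalgebra.mul_mem _ hp hp', ?_,
        fun y hy => by rw [mul_smul, hpy' y hy, hpy y hy]⟩
      rw [add_sub_add_comm, smul_add, mul_smul p p' (z' - u'), hpz', smul_zero,
        hS.jmAlg_comm hp hp', mul_smul, hpz, smul_zero, add_zero]
    | smul c z _ h1 =>
      obtain ⟨u, hu, p, hp, hpz, hpy⟩ := h1
      exact ⟨c • u, Submodule.smul_mem _ _ hu, p, hp,
        by rw [← smul_sub, smul_comm, hpz, smul_zero], hpy⟩
  obtain ⟨u, hu, p, -, hpz, hpy⟩ := key z hz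
  have hua : IsEig J n a u := by
    intro i hi
    clear hpz
    induction hu using Submodule.span_induction with
    | mem y hy => exact hy.2 i hi
    | zero => simp
    | add y y' _ _ h1 h2 => rw [smul_add, smul_add, h1, h2]
    | smul c y _ h1 => rw [smul_comm, h1, smul_comm]
  have hzu : IsEig J n a (z - u) := fun i hi => by
    rw [smul_sub, smul_sub, ha i hi, hua i hi]
  rw [hpy _ hzu, sub_eq_zero] at hpz
  rwa [hpz]

variable {a : ℕ → K} {x : V}

theorem baxter_smul {i : ℕ} {c d : K} {y : V} (hcd : c ≠ d) (hc : J i • y = c • y)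
    (hd : J (i + 1) • y = d • y) :
    (s i + algebraMap K A (baxterCoeff q c d)) • y = (c - d)⁻¹ • inter q s J i • y := by
  rw [inter_smul hc hd, smul_add, inv_smul_smul₀ (sub_ne_zero.2 hcd), add_smul, algebraMap_smul,
    baxterCoeff, div_eq_inv_mul, smul_smul]

theorem Reaches.isEig (hS : IsJMSystem q v n s J) (hx : IsEig J n a x) {w : Perm ℕ} {y : V}
    (h : Reaches q s n a x w y) : IsEig J n (fun j => a (w j)) y := by
  induction h with
  | refl => exact hx
  | step w y i hi hw hsep hy ih =>
    have h1 := ih i (by omega)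
    have h2 := ih (i + 1) hi
    simp only [Perm.mul_apply, swap_apply_left, swap_apply_right] at h1 h2
    rw [baxter_smul hsep.1 h1 h2]
    have h3 := hS.isEig_inter_smul le_rfl hi ih
    simp only [Perm.mul_apply, swap_apply_self] at h3
    intro j hj
    rw [smul_comm, h3 j hj, smul_comm]

/-- Each step is invertible, because the square of its intertwiner is a nonzero scalar on separated
entries. -/
theorem Reaches.exists_smul_eq (hS : IsJMSystem q v n s J) (hq : q ≠ 0) (hx : IsEig J n a x)
    {w : Perm ℕ} {y : V} (h : Reaches q s n a x w y) : ∃ r : A, r • y = x := by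
  induction h with
  | refl => exact ⟨1, one_smul _ _⟩
  | step w y i hi hw hsep hy ih =>
    obtain ⟨r, hr⟩ := ih
    have h1 := hy.isEig hS hx i (by omega)
    have h2 := hy.isEig hS hx (i + 1) hi
    simp only [Perm.mul_apply, swap_apply_left, swap_apply_right] at h1 h2
    rw [baxter_smul hsep.1 h1 h2]
    set c := a (w (i + 1))
    set d := a (w i)
    have h3 := hS.inter_inter_smul' hq hi h1 h2
    have h4 : -((d - q ^ 2 * c) * (d - (q ^ 2)⁻¹ * c)) ≠ 0 := by
      refine neg_ne_zero.2 (mul_ne_zero (sub_ne_zero.2 hsep.2.2) (sub_ne_zero.2 fun h => ?_))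
      exact hsep.2.1 (by rw [h, mul_inv_cancel_left₀ (pow_ne_zero 2 hq)])
    refine ⟨r * (((c - d) * (-((d - q ^ 2 * c) * (d - (q ^ 2)⁻¹ * c)))⁻¹) • inter q s J i), ?_⟩
    rw [mul_smul, smul_assoc, smul_comm (inter q s J i), h3]
    refine (congrArg (r • ·) ?_).trans hr
    rw [smul_smul, smul_smul]
    convert one_smul K y using 2
    have h5 := sub_ne_zero.2 hsep.1
    generalize -((d - q ^ 2 * c) * (d - (q ^ 2)⁻¹ * c)) = κ at *
    field_simp

/-- The span of the vectors reached from a common eigenvector is a submodule. -/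
theorem smul_mem_span_reaches (hS : IsJMSystem q v n s J) (hP : SemisimpleOver q v n)
    (hn : 0 < n) (hx : IsEig J n a x) (r : A) {y : V}
    (hy : y ∈ Submodule.span K {y | ∃ w, Reaches q s n a x w y}) :
    r • y ∈ Submodule.span K {y | ∃ w, Reaches q s n a x w y} := by
  set M := Submodule.span K {y | ∃ w, Reaches q s n a x w y} with hM
  refine smul_mem_of_generators hS.generate M (fun r hr y hy => ?_) r hy
  suffices h : ∀ w y, Reaches q s n a x w y → r • y ∈ M by
    induction hy using Submodule.span_induction with
    | mem y hy => obtain ⟨w, hw⟩ := hy; exact h w y hw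
    | zero => rw [smul_zero]; exact M.zero_mem
    | add y y' _ _ h1 h2 => rw [smul_add]; exact M.add_mem h1 h2
    | smul c y _ h1 => rw [smul_comm]; exact M.smul_mem c h1
  intro w y hw
  have hyM : y ∈ M := Submodule.subset_span ⟨w, hw⟩
  have heig := hw.isEig hS hx
  rcases hr with rfl | ⟨i, hi, rfl⟩
  · rw [heig 0 hn]
    exact M.smul_mem _ hyM
  have hi : i + 1 < n := hi
  have h1 := heig i (by omega)
  have h2 := heig (i + 1) hi
  beta_reduce at h1 h2
  by_cases hsep : Separated q (a (w i)) (a (w (i + 1)))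
  · rcases lt_or_ge (w i) (w (i + 1)) with hlt | hge
    · have h3 := Reaches.step_of_eq (w := w * swap i (i + 1)) (i := i) hi
        (by rw [mul_assoc, swap_mul_self, mul_one]) (by rw [Perm.mul_apply, swap_apply_right])
        (by rw [Perm.mul_apply, swap_apply_left]) hlt hsep hw
      have h4 : s i • y = (s i + algebraMap K A (baxterCoeff q (a (w i)) (a (w (i + 1))))) • y -
          baxterCoeff q (a (w i)) (a (w (i + 1))) • y := by
        rw [add_smul, algebraMap_smul, add_sub_cancel_right]
      rw [h4]
      exact M.sub_mem (Submodule.subset_span ⟨_, h3⟩) (M.smul_mem _ hyM)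
    · have hlt : w (i + 1) < w i := lt_of_le_of_ne hge fun h => by
        have := w.injective h
        omega
      obtain ⟨z, hz⟩ := (hw.separatedPerm.mul_swap hi
        fun h => absurd h (not_lt.2 hlt.le)).exists_reaches (s := s) (x := x)
      -- By uniqueness `y` is the step from `z`, whatever path defined it; the quadratic relation
      -- then writes `s i • y` in terms of `y` and `z`.
      have h3 := hw.unique hS (Reaches.step w z i hi hlt hsep.symm hz)
      set γ := baxterCoeff q (a (w (i + 1))) (a (w i))
      have hzM : z ∈ M := Submodule.subset_span ⟨_, hz⟩
      have h4 : s i • z = y - γ • z := by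
        rw [h3, add_smul, algebraMap_smul, add_sub_cancel_right]
      have h5 : s i • y = (q - q⁻¹) • (y - γ • z) + z + γ • (y - γ • z) := by
        conv_lhs => rw [h3]
        rw [← mul_smul, mul_add, hS.quad i hi, add_smul, add_smul, one_smul, smul_assoc, h4,
          ← Algebra.commutes, mul_smul, algebraMap_smul, h4]
      rw [h5]
      exact M.add_mem (M.add_mem (M.smul_mem _ (M.sub_mem hyM (M.smul_mem _ hzM))) hzM)
        (M.smul_mem _ (M.sub_mem hyM (M.smul_mem _ hzM)))
  -- Without separation the intertwiner kills `y`, which makes `s i • y` a multiple of `y`.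
  · obtain ⟨h3, h4⟩ := hS.inter_smul_eq_zero hP hi heig hsep
    by_cases hy0 : y = 0
    · rw [hy0, smul_zero]; exact M.zero_mem
    · rw [inter_smul h1 h2] at h3
      have h5 := eq_neg_of_add_eq_zero_left h3
      rw [← inv_smul_smul₀ (sub_ne_zero.2 (h4 hy0)) (s i • y), h5]
      exact M.smul_mem _ (M.neg_mem (M.smul_mem _ hyM))

theorem smul_mem_span_reaches_self (hS : IsJMSystem q v n s J) (hP : SemisimpleOver q v n)
    (hn : 0 < n) (hx : IsEig J n a x) (r : A) :
    r • x ∈ Submodule.span K {y | ∃ w, Reaches q s n a x w y} :=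
  smul_mem_span_reaches hS hP hn hx r (Submodule.subset_span ⟨1, Reaches.refl⟩)

/-- In a cyclic module generated by a common eigenvector `x`, the vectors with the same eigenvalues
are the multiples of `x`. -/
theorem IsJMSystem.exists_eq_smul (hS : IsJMSystem q v n s J) (hP : SemisimpleOver q v n)
    (hn : 0 < n) (hx : IsEig J n a x) {r : A} (hr : IsEig J n a (r • x)) :
    ∃ c : K, r • x = c • x := by
  have h1 := hS.mem_span_of_isEig (E := {y | ∃ w, Reaches q s n a x w y})
    (fun y ⟨w, hw⟩ => ⟨_, hw.isEig hS hx⟩) (smul_mem_span_reaches_self hS hP hn hx r) hr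
  have h2 : Submodule.span K {y ∈ {y | ∃ w, Reaches q s n a x w y} | IsEig J n a y} ≤
      Submodule.span K {x} := by
    refine Submodule.span_le.2 ?_
    rintro y ⟨⟨w, hw⟩, hy⟩
    by_cases hy0 : y = 0
    · rw [hy0]; exact Submodule.zero_mem _
    · have hw1 : w = 1 := hw.separatedPerm.eq_one fun i hi => by
        have h3 := (hw.isEig hS hx i hi).symm.trans (hy i hi)
        rw [← sub_eq_zero, ← sub_smul, smul_eq_zero, sub_eq_zero] at h3
        exact h3.resolve_right hy0
      subst hw1
      rw [hw.unique hS Reaches.refl]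
      exact Submodule.mem_span_singleton_self x
  obtain ⟨c, hc⟩ := Submodule.mem_span_singleton.1 (h2 h1)
  exact ⟨c, hc.symm⟩

/-- A cyclic module generated by a common eigenvector is generated by each of its nonzero common
eigenvectors. -/
theorem IsJMSystem.exists_smul_eq_of_ne_zero (hS : IsJMSystem q v n s J)
    (hP : SemisimpleOver q v n) (hn : 0 < n) (hx : IsEig J n a x) {b : ℕ → K} {r : A}
    (hr : IsEig J n b (r • x)) (h0 : r • x ≠ 0) : ∃ r' : A, r' • r • x = x := by
  have h1 := hS.mem_span_of_isEig (E := {y | ∃ w, Reaches q s n a x w y})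
    (fun y ⟨w, hw⟩ => ⟨_, hw.isEig hS hx⟩) (smul_mem_span_reaches_self hS hP hn hx r) hr
  have h2 : ({y ∈ {y | ∃ w, Reaches q s n a x w y} | IsEig J n b y}).Nonempty := by
    rw [Set.nonempty_iff_ne_empty]
    intro h
    rw [h, Submodule.span_empty, Submodule.mem_bot] at h1
    exact h0 h1
  obtain ⟨y, ⟨w, hw⟩, hy⟩ := h2
  obtain ⟨t, ht⟩ := hw.exists_smul_eq hS hP.q_ne_zero hx
  have h3 : r • x = (r * t) • y := by rw [mul_smul, ht]
  obtain ⟨c, hc⟩ := hS.exists_eq_smul hP hn hy (r := r * t) (by rwa [← h3])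
  rw [← h3] at hc
  have hc0 : c ≠ 0 := by
    rintro rfl
    exact h0 (by rw [hc, zero_smul])
  exact ⟨c⁻¹ • t, by rw [hc, smul_assoc, smul_comm t, inv_smul_smul₀ hc0, ht]⟩

end CyclicModule

/-! ### Simple modules, centralizer of K[J], central elements -/

section Consequences

variable {K A V W : Type*} [Field K] [Ring A] [Algebra K A] [AddCommGroup V] [Module K V]
  [Module A V] [IsScalarTower K A V] [AddCommGroup W] [Module K W]
  [Module A W] [IsScalarTower K A W]
  {m n : ℕ} {q : K} {v : Fin m → K} {s J : ℕ → A}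

namespace IsJMSystem

theorem jDiagonalizable (hS : IsJMSystem q v n s J) (hP : SemisimpleOver q v n) :
    JDiagonalizable K J n n V :=
  (hS.jDiagonalizable_and_isContentString hP le_rfl).1

theorem exists_isEig_ne_zero (hS : IsJMSystem q v n s J) (hP : SemisimpleOver q v n) {y : V}
    (hy : y ≠ 0) : ∃ r : A, r • y ≠ 0 ∧ ∃ a : ℕ → K, IsEig J n a (r • y) := by
  by_contra! h
  refine hy (Submodule.span_induction (p := fun z _ => z = 0) ?_ rfl ?_ ?_
    (hS.jDiagonalizable hP y))
  · rintro z ⟨⟨r, -, rfl⟩, a, ha⟩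
    by_contra h0
    exact h r h0 a ha
  · rintro _ _ _ _ rfl rfl
    exact add_zero 0
  · rintro c _ _ rfl
    exact smul_zero c

/-- The cyclic module generated by a common eigenvector is simple. -/
theorem exists_smul_smul_eq (hS : IsJMSystem q v n s J) (hP : SemisimpleOver q v n)
    (hn : 0 < n) {a : ℕ → K} {x : V} (hx : IsEig J n a x) {r : A} (hr : r • x ≠ 0) :
    ∃ r' : A, r' • r • x = x := by
  obtain ⟨t, ht, b, hb⟩ := hS.exists_isEig_ne_zero hP hr
  rw [← mul_smul] at ht hb
  obtain ⟨r', hr'⟩ := hS.exists_smul_eq_of_ne_zero hP hn hx hb ht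
  exact ⟨r' * t, by rw [mul_smul, ← mul_smul t, hr']⟩

/-- The pair `(x, y)` is a common eigenvector of `V × W`, so it generates a simple submodule; its
projections to `V` and `W` are nonzero, hence bijective. -/
theorem nonempty_linearEquiv (hS : IsJMSystem q v n s J) (hP : SemisimpleOver q v n)
    (hn : 0 < n) [IsSimpleModule A V] [IsSimpleModule A W] {a : ℕ → K} {x : V} {y : W}
    (hx0 : x ≠ 0) (hy0 : y ≠ 0) (hx : IsEig J n a x) (hy : IsEig J n a y) :
    Nonempty (V ≃ₗ[A] W) := by
  have hxy : IsEig J n a (x, y) := fun i hi => Prod.ext (hx i hi) (hy i hi)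
  let M := Submodule.span A {(x, y)}
  have hmem : (x, y) ∈ M := Submodule.mem_span_singleton_self _
  have key : ∀ z ∈ M, z ≠ 0 → ∃ r' : A, r' • z = (x, y) := by
    intro z hz hz0
    obtain ⟨r, rfl⟩ := Submodule.mem_span_singleton.1 hz
    exact hS.exists_smul_smul_eq hP hn hxy hz0
  let f : M →ₗ[A] V := LinearMap.fst A V W ∘ₗ M.subtype
  let g : M →ₗ[A] W := LinearMap.snd A V W ∘ₗ M.subtype
  have hf : Function.Bijective f := by
    refine ⟨(injective_iff_map_eq_zero f).2 fun z hz => ?_, LinearMap.surjective_of_ne_zero ?_⟩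
    · by_contra hz0
      obtain ⟨r, hr⟩ := key z z.2 (by simpa using hz0)
      have h1 : r • f z = x := congrArg Prod.fst hr
      rw [hz, smul_zero] at h1
      exact hx0 h1.symm
    · intro h
      exact hx0 (congrArg (fun f => f ⟨(x, y), hmem⟩) h)
  have hg : Function.Bijective g := by
    refine ⟨(injective_iff_map_eq_zero g).2 fun z hz => ?_, LinearMap.surjective_of_ne_zero ?_⟩
    · by_contra hz0
      obtain ⟨r, hr⟩ := key z z.2 (by simpa using hz0)
      have h1 : r • g z = y := congrArg Prod.snd hr
      rw [hz, smul_zero] at h1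
      exact hy0 h1.symm
    · intro h
      exact hy0 (congrArg (fun f => f ⟨(x, y), hmem⟩) h)
  exact ⟨(LinearEquiv.ofBijective f hf).symm.trans (LinearEquiv.ofBijective g hg)⟩

/-- An element that commutes with all Jucys–Murphy elements is a polynomial in them. -/
theorem mem_jmAlg_of_commute (hS : IsJMSystem q v n s J) (hP : SemisimpleOver q v n)
    (hn : 0 < n) {x : A} (hx : ∀ i < n, x * J i = J i * x) : x ∈ jmAlg K J n := by
  suffices h : ∀ z ∈ Submodule.span K
      {z : A | (∃ r ∈ jmAlg K J n, z = r • (1 : A)) ∧ ∃ a : ℕ → K, IsEig J n a z},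
      x * z ∈ jmAlg K J n by
    simpa using h 1 (hS.jDiagonalizable hP (1 : A))
  intro z hz
  induction hz using Submodule.span_induction with
  | mem z hz =>
    obtain ⟨⟨r, hr, rfl⟩, a, ha⟩ := hz
    rw [smul_eq_mul, mul_one] at ha ⊢
    -- In the left regular module, multiplication by `x` on the left preserves the string of `r`
    -- because `x` commutes with every `J i`.
    have h1 : IsEig J n a (x • r) := fun i hi => by
      rw [smul_eq_mul, smul_eq_mul, ← mul_assoc, ← hx i hi, mul_assoc, ← smul_eq_mul (J i) r,
        ha i hi, mul_smul_comm]
    obtain ⟨c, hc⟩ := hS.exists_eq_smul hP hn ha h1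
    rw [← smul_eq_mul, hc]
    exact Subalgebra.smul_mem _ hr c
  | zero => rw [mul_zero]; exact Subalgebra.zero_mem _
  | add y y' _ _ h1 h2 => rw [mul_add]; exact Subalgebra.add_mem _ h1 h2
  | smul c y _ h1 => rw [mul_smul_comm]; exact Subalgebra.smul_mem _ h1 c

/-- The correction terms in `J_mul_s` and `J_succ_mul_s` cancel, so `s i` commutes with `J i + J (i
+ 1)` and with the remaining summands. -/
theorem sum_J_mem_center (hS : IsJMSystem q v n s J) (hn : 0 < n) :
    ∑ i ∈ Finset.range n, J i ∈ Subalgebra.center K A := by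
  have h : ∀ r ∈ insert (J 0) (s '' {i | i + 1 < n}),
      r * ∑ i ∈ Finset.range n, J i = (∑ i ∈ Finset.range n, J i) * r := by
    rintro _ (rfl | ⟨i, hi, rfl⟩)
    · rw [Finset.mul_sum, Finset.sum_mul]
      exact Finset.sum_congr rfl fun i hi => hS.J_comm 0 i hn (Finset.mem_range.1 hi)
    · have hi : i + 1 < n := hi
      have h1 : i ∈ Finset.range n := Finset.mem_range.2 (by omega)
      have h2 : i + 1 ∈ (Finset.range n).erase i := by simp; omega
      rw [← Finset.add_sum_erase _ _ h1, ← Finset.add_sum_erase _ _ h2, mul_add, mul_add, add_mul,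
        add_mul, hS.J_mul_s hi, hS.J_succ_mul_s hi, Finset.mul_sum, Finset.sum_mul,
        Finset.sum_congr rfl fun j hj => ?_]
      · abel
      · simp only [Finset.mem_erase, Finset.mem_range] at hj
        exact hS.s_J i j hi hj.2.2 hj.2.1 hj.1
  rw [Subalgebra.mem_center_iff]
  intro r
  have hr : r ∈ Algebra.adjoin K (insert (J 0) (s '' {i | i + 1 < n})) :=
    hS.generate ▸ Algebra.mem_top
  induction hr using Algebra.adjoin_induction with
  | mem r hr => exact h r hr
  | algebraMap c => exact Algebra.commutes c _
  | add r r' _ _ h1 h2 => rw [add_mul, mul_add, h1, h2]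
  | mul r r' _ _ h1 h2 => rw [mul_assoc, h2, ← mul_assoc, h1, mul_assoc]

end IsJMSystem

theorem SemisimpleOver.mono (hP : SemisimpleOver q v n) {k : ℕ} (hk : k ≤ n) :
    SemisimpleOver q v k where
  q_ne_zero := hP.q_ne_zero
  v_ne_zero := hP.v_ne_zero
  v_ne := hP.v_ne
  pow_ne_one h i h1 h2 := hP.pow_ne_one (h.trans hk) i h1 (h2.trans hk)
  pow_mul_ne i hi := hP.pow_mul_ne i (hi.trans_le hk)

end Consequences

/-! ### The three assertions for H(m,1,n) -/

section CyclotomicAlgebra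

variable {m n : ℕ}

/-- The basis is indexed by the strings that occur, with one eigenvector chosen for each. Different
strings give independence; diagonalizability and multiplicity one give spanning. -/
theorem IsJMSystem.exists_basis {K V : Type} {A : Type*} [Field K] [Ring A] [Algebra K A]
    [AddCommGroup V] [Module K V] [Module A V] [IsScalarTower K A V] [IsSimpleModule A V]
    {q : K} {v : Fin m → K} {s J : ℕ → A} (hS : IsJMSystem q v n s J)
    (hP : SemisimpleOver q v n) (hn : 0 < n) :
    ∃ (ι : Type) (b : Module.Basis ι K V) (a : ι → Fin n → K), Function.Injective a ∧
      ∀ t (i : Fin n), J i • b t = a t i • b t := by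
  let ι := {a : Fin n → K // ∃ x : V, x ≠ 0 ∧ ∀ i : Fin n, J i • x = a i • x}
  choose e he0 he using fun t : ι => t.2
  -- The value 0 beyond `n` is immaterial, since `IsEig J n` sees only indices below `n`.
  let ext : (Fin n → K) → ℕ → K := fun a i => if h : i < n then a ⟨i, h⟩ else 0
  have hext : ∀ t, IsEig J n (ext t.1) (e t) := fun t i hi => by
    simp only [ext, dif_pos hi]
    exact he t ⟨i, hi⟩
  have hli : LinearIndependent K e := by
    rw [linearIndependent_iff_notMem_span]
    intro t ht
    have h1 := hS.mem_span_of_isEig (E := e '' (Set.univ \ {t}))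
      (fun y ⟨u, _, hu⟩ => ⟨ext u.1, hu ▸ hext u⟩) ht (hext t)
    have h2 : {y ∈ e '' (Set.univ \ {t}) | IsEig J n (ext t.1) y} = ∅ := by
      rw [Set.eq_empty_iff_forall_notMem]
      rintro y ⟨⟨u, ⟨-, hut⟩, rfl⟩, hy⟩
      refine hut (Subtype.ext (funext fun i => ?_))
      have h3 := (he u i).symm.trans (hy i i.2)
      rw [← sub_eq_zero, ← sub_smul, smul_eq_zero, sub_eq_zero] at h3
      simpa [ext] using h3.resolve_right (he0 u)
    rw [h2, Submodule.span_empty, Submodule.mem_bot] at h1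
    exact he0 t h1
  have hsp : ⊤ ≤ Submodule.span K (Set.range e) := by
    rintro y -
    refine Submodule.span_le.2 ?_ (hS.jDiagonalizable hP y)
    rintro z ⟨-, a, ha⟩
    by_cases hz : z = 0
    · rw [hz]; exact Submodule.zero_mem _
    · let t : ι := ⟨fun i => a i, z, hz, fun i => ha i i.2⟩
      obtain ⟨r, hr⟩ := IsSimpleModule.toSpanSingleton_surjective A (he0 t) z
      have hr : r • e t = z := hr
      have h1 : IsEig J n (ext t.1) z := ha.congr fun i hi => by simp [ext, t, hi]
      rw [← hr] at h1
      obtain ⟨c, hc⟩ := hS.exists_eq_smul hP hn (hext t) h1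
      rw [← hr, hc]
      exact Submodule.smul_mem _ c (Submodule.subset_span ⟨t, rfl⟩)
  exact ⟨ι, Module.Basis.mk hli hsp, fun t => t.1, Subtype.val_injective, fun t i => by
    rw [Module.Basis.mk_apply]; exact he t i⟩

theorem jucysMurphyDistinguish {K : Type} [Field K] {q : K} {v : Fin m → K}
    (hP : SemisimpleOver q v n) (hn : 0 < n) : JucysMurphyDistinguish q v n := by
  have hS := isJMSystem q v hn
  refine ⟨fun V _ _ _ _ _ => ?_, fun V W _ _ _ _ _ _ _ _ _ _ a x y hx0 hy0 hx hy => ?_⟩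
  · obtain ⟨ι, b, a, ha, hb⟩ := hS.exists_basis (V := V) hP hn
    exact ⟨ι, b, a, ha, fun t i => by rw [← jm_of_lt q v i.2]; exact hb t i⟩
  · refine hS.nonempty_linearEquiv hP hn (a := fun i => if h : i < n then a ⟨i, h⟩ else 0) hx0 hy0
      (fun i hi => ?_) (fun i hi => ?_)
    · beta_reduce
      rw [jm_of_lt q v hi, dif_pos hi]
      exact hx ⟨i, hi⟩
    · beta_reduce
      rw [jm_of_lt q v hi, dif_pos hi]
      exact hy ⟨i, hi⟩

variable {K : Type*} [Field K] {q : K} {v : Fin m → K}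

theorem adjoin_jucysMurphySet (q : K) (v : Fin m → K) (n : ℕ) :
    Algebra.adjoin K (jucysMurphySet q v n) = jmAlg K (jm q v n) n := by
  unfold jmAlg jucysMurphySet
  congr 1
  ext x
  constructor
  · rintro ⟨i, rfl⟩
    exact ⟨i, i.2, jm_of_lt q v i.2⟩
  · rintro ⟨i, hi, rfl⟩
    exact ⟨⟨i, hi⟩, (jm_of_lt q v hi).symm⟩

theorem isMaximalCommutativeSet_jucysMurphySet (hP : SemisimpleOver q v n) (hn : 0 < n) :
    IsMaximalCommutativeSet K (jucysMurphySet q v n) := by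
  have hS := isJMSystem q v hn
  rw [IsMaximalCommutativeSet, adjoin_jucysMurphySet]
  exact ⟨fun x hx y hy => hS.jmAlg_comm hx hy, fun B hB hle x hx =>
    hS.mem_jmAlg_of_commute hP hn fun i hi => hB x hx _ (hle (J_mem_jmAlg hi))⟩

theorem incl_sig {k : ℕ} (hkn : k ≤ n) {i : ℕ} (hi : i + 1 < k) :
    incl q v hkn (sig q v k i) = sig q v n i := by
  rw [sig_of_lt q v hi, sig_of_lt q v (hi.trans_le hkn), sigma, incl,
    RingQuot.liftAlgHom_mkAlgHom_apply, lift_freeSigma]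

theorem incl_jm {k : ℕ} (hkn : k ≤ n) {i : ℕ} (hi : i < k) :
    incl q v hkn (jm q v k i) = jm q v n i := by
  induction i with
  | zero =>
    rw [jm_zero q v hi, jm_zero q v (hi.trans_le hkn), tau, incl,
      RingQuot.liftAlgHom_mkAlgHom_apply, lift_freeTau]
  | succ i ih =>
    rw [jm_succ q v hi, jm_succ q v (hi.trans_le hkn), map_mul, map_mul, incl_sig hkn hi,
      ih (by omega)]

/-- Each Jucys–Murphy element is a difference of two consecutive central sums. Conversely, a central
element of H(m,1,k) is a polynomial in the Jucys–Murphy elements there, and these map to those of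
H(m,1,n); injectivity of the map plays no role. -/
theorem adjoin_jucysMurphySet_eq_centresSubalgebra (hP : SemisimpleOver q v n) :
    Algebra.adjoin K (jucysMurphySet q v n) = centresSubalgebra q v n := by
  rw [adjoin_jucysMurphySet]
  refine le_antisymm (Algebra.adjoin_le ?_) (Algebra.adjoin_le ?_)
  · have hsum : ∀ k, 1 ≤ k → k ≤ n →
        ∑ i ∈ Finset.range k, jm q v n i ∈ centresSubalgebra q v n := by
      intro k hk hkn
      refine Algebra.subset_adjoin ⟨k, hk, hkn, _, (isJMSystem q v hk).sum_J_mem_center hk, ?_⟩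
      rw [map_sum]
      exact Finset.sum_congr rfl fun i hi => incl_jm hkn (Finset.mem_range.1 hi)
    rintro _ ⟨i, hi, rfl⟩
    have hi : i < n := hi
    have h1 := hsum (i + 1) (by omega) hi
    rcases Nat.eq_zero_or_pos i with rfl | h0
    · simpa using h1
    · have h2 := Subalgebra.sub_mem _ h1 (hsum i h0 hi.le)
      rwa [Finset.sum_range_succ, add_sub_cancel_left] at h2
  · rintro _ ⟨k, hk, hkn, z, hz, rfl⟩
    have h1 : z ∈ jmAlg K (jm q v k) k :=
      (isJMSystem q v hk).mem_jmAlg_of_commute (hP.mono hkn) hk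
        fun i _ => (Subalgebra.mem_center_iff.1 hz _).symm
    have h2 : jmAlg K (jm q v k) k ≤ (jmAlg K (jm q v n) n).comap (incl q v hkn) := by
      refine Algebra.adjoin_le ?_
      rintro _ ⟨i, hi, rfl⟩
      have hi : i < k := hi
      change incl q v hkn (jm q v k i) ∈ jmAlg K (jm q v n) n
      rw [incl_jm hkn hi]
      exact J_mem_jmAlg (hi.trans_le hkn)
    exact h2 h1

end CyclotomicAlgebra

/-! ### Numerical and generic parameters -/

section Parameters

variable {m n : ℕ}

theorem SemisimpleParameters.semisimpleOver {q : ℂ} {v : Fin m → ℂ} (hn : 1 ≤ n)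
    (h : SemisimpleParameters q v n) (hq : 2 ≤ n → q ^ 2 ≠ 1) : SemisimpleOver q v n where
  q_ne_zero := h.q_ne_zero
  v_ne_zero := h.v_ne_zero
  v_ne j k hjk h1 := h.sub_ne_zero 0 (by omega) (by omega) j k hjk (by simp [h1])
  pow_ne_one hn2 i hi hin h1 := by
    -- The geometric sum times `q ^ 2 - 1` is `(q ^ 2) ^ i - 1`; the nonvanishing sums therefore
    -- suffice only together with `q ^ 2 ≠ 1`.
    have h2 := geom_sum_mul (q ^ 2) i
    rw [h1, sub_self, mul_eq_zero, sub_eq_zero] at h2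
    have h3 := h.sum_ne_zero (i - 1) (by omega)
    rw [Nat.sub_add_cancel hi] at h3
    simp only [pow_mul] at h3
    exact h2.elim h3 (hq hn2)
  pow_mul_ne i hi j k hjk h1 := by
    refine h.sub_ne_zero i (by omega) (by omega) j k hjk ?_
    rw [← h1, zpow_mul, zpow_natCast, zpow_ofNat]
    ring

/-- Polynomials are told apart in the fraction field by specializing the indeterminates at a point
`f`. -/
theorem algebraMap_genericField_ne {p r : MvPolynomial (Option (Fin m)) ℂ}
    (f : Option (Fin m) → ℂ) (h : MvPolynomial.eval f p ≠ MvPolynomial.eval f r) :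
    algebraMap _ (GenericField m) p ≠ algebraMap _ (GenericField m) r := fun h1 =>
  h (congrArg _ (IsFractionRing.injective (MvPolynomial (Option (Fin m)) ℂ) (GenericField m) h1))

theorem semisimpleOver_generic (m n : ℕ) :
    SemisimpleOver (genericQ m) (genericV m) n where
  q_ne_zero := by
    rw [genericQ, ← map_zero (algebraMap (MvPolynomial (Option (Fin m)) ℂ) (GenericField m))]
    exact algebraMap_genericField_ne (fun _ => 1) (by simp)
  v_ne_zero j := by
    rw [genericV, ← map_zero (algebraMap (MvPolynomial (Option (Fin m)) ℂ) (GenericField m))]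
    exact algebraMap_genericField_ne (fun _ => 1) (by simp)
  v_ne j k hjk := by
    classical
    exact algebraMap_genericField_ne (fun o => if o = some j then 2 else 1)
      (by simp [hjk.symm])
  pow_ne_one _ i hi _ := by
    rw [genericQ, ← map_pow, ← map_pow,
      ← map_one (algebraMap (MvPolynomial (Option (Fin m)) ℂ) (GenericField m))]
    refine algebraMap_genericField_ne (fun _ => 2) ?_
    simp only [map_pow, MvPolynomial.eval_X, map_one]
    norm_cast
    exact (Nat.one_lt_pow (by omega) (by norm_num)).ne'
  pow_mul_ne i _ j k hjk := by
    classical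
    rw [genericQ, genericV, genericV, ← map_pow, ← map_pow, ← map_mul]
    exact algebraMap_genericField_ne (fun o => if o = some j then 2 else 1)
      (by simp [hjk.symm])

end Parameters

end CyclotomicHecke

end

theorem mainTheorem4 (m n : ℕ) (hm : 1 ≤ m) (hn : 1 ≤ n) :
    -- numerical parameters, the semisimple situation
    (∀ (q : ℂ) (v : Fin m → ℂ), CyclotomicHecke.SemisimpleParameters q v n →
      (2 ≤ n → q ^ 2 ≠ 1) →
      CyclotomicHecke.JucysMurphyDistinguish q v n ∧
      CyclotomicHecke.IsMaximalCommutativeSet ℂ (CyclotomicHecke.jucysMurphySet q v n) ∧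
      Algebra.adjoin ℂ (CyclotomicHecke.jucysMurphySet q v n) =
        CyclotomicHecke.centresSubalgebra q v n) ∧
    -- the generic algebra, where the parameters are indeterminates
    (CyclotomicHecke.JucysMurphyDistinguish (CyclotomicHecke.genericQ m)
        (CyclotomicHecke.genericV m) n ∧
      CyclotomicHecke.IsMaximalCommutativeSet (CyclotomicHecke.GenericField m)
        (CyclotomicHecke.jucysMurphySet (CyclotomicHecke.genericQ m)
          (CyclotomicHecke.genericV m) n) ∧
      Algebra.adjoin (CyclotomicHecke.GenericField m)
          (CyclotomicHecke.jucysMurphySet (CyclotomicHecke.genericQ m)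
            (CyclotomicHecke.genericV m) n) =
        CyclotomicHecke.centresSubalgebra (CyclotomicHecke.genericQ m)
          (CyclotomicHecke.genericV m) n) := by
  refine ⟨fun q v h hq => ?_, ?_⟩
  · have hP := h.semisimpleOver hn hq
    exact ⟨CyclotomicHecke.jucysMurphyDistinguish hP hn,
      CyclotomicHecke.isMaximalCommutativeSet_jucysMurphySet hP hn,
      CyclotomicHecke.adjoin_jucysMurphySet_eq_centresSubalgebra hP⟩
  · have hP := CyclotomicHecke.semisimpleOver_generic m n
    exact ⟨CyclotomicHecke.jucysMurphyDistinguish hP hn,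
      CyclotomicHecke.isMaximalCommutativeSet_jucysMurphySet hP hn,
      CyclotomicHecke.adjoin_jucysMurphySet_eq_centresSubalgebra hP⟩
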